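/- **Theorem (trace theorem with non-local derivative on a finite interval).** *Notation.* Write $\mathbb R_+=(0,\infty)$. For $\phi:\mathbb R_+\to\mathbb R_+$ put $s_\phi(\lambda)=\sup_{t>0}\phi(\lambda t)/\phi(t)\in(0,\infty]$, and for $a<b$ let $\mathcal I_o(a,b)$ be the set of all $\phi:\mathbb R_+\to\mathbb R_+$ with $s_\phi(\lambda)=o(\lambda^a)$ as $\lambda\to0$ and $s_\phi(\lambda)=o(\lambda^b)$ as $\lambda\to\infty$. For $p\in(1,\infty)$, a measurable $w:\mathbb R\to[0,\infty)$ is in $A_p$ if $$[w]_{A_p}=\sup_{a<b}\Big(\frac1{b-a}\int_a^b w\,dt\Big)\Big(\frac1{b-a}\int_a^b w^{-1/(p-1)}dt\Big)^{p-1}<\infty ,$$ and then $W(t)=\int_0^t w(s)\,ds$. For decreasing $\kappa:\mathbb R_+\to\mathbb R_+$ put $\kappa^*(t)=\inf\{s>0:\kappa(s)\le 1/t\}$. For an interpolation couple $(X_0,X_1)$ let $K(t,a)=\inf\{\|a_0\|_{X_0}+t\|a_1\|_{X_1}: a=a_0+a_1,\ a_0\in X_0,\ a_1\in X_1\}$,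 and for $\phi\in\mathcal I_o(0,1)$ let $(X_0,X_1)_{\phi,p}$ be the set of all $a\in X_0+X_1$ with $$\|a\|_{(X_0,X_1)_{\phi,p}}=\Big(\int_0^\infty \phi(t^{-1})^pK(t,a)^p\,\frac{dt}{t}\Big)^{1/p}<\infty .$$ *Statement.* Let $T\in(0,\infty)$ and $p\in(1,\infty)$. Let $X_0,X_1$ be Banach spaces with $X_0$ continuously embedded into $X_1$, say $\|a\|_{X_1}\le N_{X_0,X_1}\|a\|_{X_0}$ for all $a\in X_0$. Let $w\in A_p$, let $\kappa:\mathbb R_+\to\mathbb R_+$ be right-continuous and decreasing with $\kappa\in\mathcal I_o(-1,0)$, and assume that $W\circ\kappa^*\in\mathcal I_o(0,p)$. Let $u\in L_p((0,T),w\,dt;X_0)$, $f\in L_p((0,T),w\,dt;X_1)$ and $u_0\in X_1\,(=X_0+X_1)$ satisfy $$\int_0^t\kappa(t-s)\,(u(s)-u_0)\,ds=\int_0^t f(s)\,ds\qquad\text{for almost every }t\in(0,T).$$ Then $u_0\in(X_0,X_1)_{(W\circ\kappa^*)^{1/p},p}$ and $$\|u_0\|_{(X_0,X_1)_{(W\circ\kappa^*)^{1/p},p}}\le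 N\big(\|u\|_{L_p((0,T),w\,dt;X_0)}+\|f\|_{L_p((0,T),w\,dt;X_1)}\big).$$ Here $N$ depends only on $p$, $T$, $\kappa$, an upper bound for $N_{X_0,X_1}$, an upper bound for $[w]_{A_p}$, and the growth of $W\circ\kappa^*$, the latter only through a majorant of $s_{W\circ\kappa^*}$: for all $p,T,\kappa$ as above, all $L,M\in[0,\infty)$ and every $S:\mathbb R_+\to[0,\infty]$ with $S(\lambda)=o(1)$ as $\lambda\to0$ and $S(\lambda)=o(\lambda^p)$ as $\lambda\to\infty$, one constant $N$ serves all $X_0,X_1,w,u,f,u_0$ as above with $N_{X_0,X_1}\le L$, $[w]_{A_p}\le M$ and $s_{W\circ\kappa^*}\le S$. -/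

import Mathlib

open MeasureTheory Filter Topology Set
open scoped NNReal ENNReal

universe u v

noncomputable section

namespace VolterraTrace

/-! Functions on the half line `(0, ∞)` are modelled by functions on `ℝ` of which only the values
at positive arguments are used. -/

/-- `s_φ(r) = sup_{t > 0} φ(r t) / φ(t)`, with values in `[0, ∞]`. -/
def growthSup (φ : ℝ → ℝ) (r : ℝ) : ℝ≥0∞ :=
  ⨆ (t : ℝ) (_ : 0 < t), ENNReal.ofReal (φ (r * t) / φ t)

/-- `s(r) = o(r ^ a)` as `r → 0+` and `s(r) = o(r ^ b)` as `r → ∞`. -/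
def IsLittleOEnds (a b : ℝ) (s : ℝ → ℝ≥0∞) : Prop :=
  Tendsto (fun r : ℝ => s r / ENNReal.ofReal (r ^ a)) (𝓝[>] 0) (𝓝 0) ∧
    Tendsto (fun r : ℝ => s r / ENNReal.ofReal (r ^ b)) atTop (𝓝 0)

/-- The class `I_o(a, b)` of functions `φ : (0, ∞) → (0, ∞)`. -/
def ClassIo (a b : ℝ) (φ : ℝ → ℝ) : Prop :=
  (∀ t : ℝ, 0 < t → 0 < φ t) ∧ IsLittleOEnds a b (growthSup φ)

/-- The generalized inverse `κ⁻¹(r) = inf {s > 0 : κ(s) ≤ r}`. -/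
def genInv (κ : ℝ → ℝ) (r : ℝ) : ℝ :=
  sInf {s : ℝ | 0 < s ∧ κ s ≤ r}

/-- `κ*(t) = κ⁻¹(1 / t)`. -/
def kappaStar (κ : ℝ → ℝ) (t : ℝ) : ℝ :=
  genInv κ (1 / t)

/-- The Muckenhoupt constant `[w]_{A_p}`, as an extended real; a negative power of `0` is `∞`. -/
def apConst (p : ℝ) (w : ℝ → ℝ≥0) : ℝ≥0∞ :=
  ⨆ (a : ℝ) (b : ℝ) (_ : a < b),
    ((∫⁻ t in Icc a b, (w t : ℝ≥0∞)) / ENNReal.ofReal (b - a)) *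
      ((∫⁻ t in Icc a b, (w t : ℝ≥0∞) ^ (-(1 / (p - 1)))) / ENNReal.ofReal (b - a)) ^ (p - 1)

/-- Muckenhoupt weights `w ∈ A_p(ℝ)`, for `1 < p < ∞`. -/
def IsApWeight (p : ℝ) (w : ℝ → ℝ≥0) : Prop :=
  Measurable w ∧ apConst p w < ∞

/-- `W(t) = ∫_0^t w(s) ds`. -/
def weightPrimitive (w : ℝ → ℝ≥0) (t : ℝ) : ℝ :=
  ∫ s in (0 : ℝ)..t, (w s : ℝ)

/-- The measure `w dt` on `(0, T)`. -/
def weightedMeasure (w : ℝ → ℝ≥0) (T : ℝ) : Measure ℝ :=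
  (volume.restrict (Ioo 0 T)).withDensity (fun t => (w t : ℝ≥0∞))

section Interpolation

variable {A₀ A₁ Z : Type*}
  [NormedAddCommGroup A₀] [NormedSpace ℝ A₀] [NormedAddCommGroup A₁] [NormedSpace ℝ A₁]
  [AddCommGroup Z] [Module ℝ Z]

/-- The functional `K(t, a; A₀, A₁) = inf {‖a₀‖ + t ‖a₁‖ : a = a₀ + a₁}` of two normed spaces
that are embedded in `Z` by `j₀` and `j₁`; it is `∞` if `a` is not in `A₀ + A₁`. -/
def kFunctional (j₀ : A₀ →ₗ[ℝ] Z) (j₁ : A₁ →ₗ[ℝ] Z) (t : ℝ) (a : Z) : ℝ≥0∞ :=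
  ⨅ (a₀ : A₀) (a₁ : A₁) (_ : j₀ a₀ + j₁ a₁ = a), ‖a₀‖ₑ + ENNReal.ofReal t * ‖a₁‖ₑ

/-- The norm of `(A₀, A₁)_{φ, p}`, that is
`(∫_0^∞ (φ(1 / t) K(t, a; A₀, A₁)) ^ p dt / t) ^ (1 / p)`, as an extended real. -/
def interpNorm (j₀ : A₀ →ₗ[ℝ] Z) (j₁ : A₁ →ₗ[ℝ] Z) (φ : ℝ → ℝ) (p : ℝ) (a : Z) : ℝ≥0∞ :=
  (∫⁻ t in Ioi (0 : ℝ),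
    (ENNReal.ofReal (φ t⁻¹) * kFunctional j₀ j₁ t a) ^ p * ENNReal.ofReal t⁻¹) ^ (1 / p)

/-- The generalized real interpolation space `(A₀, A₁)_{φ, p}`, for `1 ≤ p < ∞`. -/
def interpSpace (j₀ : A₀ →ₗ[ℝ] Z) (j₁ : A₁ →ₗ[ℝ] Z) (φ : ℝ → ℝ) (p : ℝ) : Set Z :=
  {a | (∃ (a₀ : A₀) (a₁ : A₁), j₀ a₀ + j₁ a₁ = a) ∧ interpNorm j₀ j₁ φ p a < ∞}

end Interpolation

end VolterraTrace

end

open VolterraTrace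

namespace VolterraTrace

/-! Integrate the equation once more, over `(0, τ)`. With `K(t) = ∫_0^t κ`, Fubini gives `∫_0^τ K(τ
- s) (u(s) - u₀) ds = ∫_0^τ (τ - s) f(s) ds`. The singular kernel `κ` has become the bounded kernel
`K(τ - ·)`, so dividing by `∫_0^τ K ~ τ² κ(τ)` writes `u₀` as an element of `X₀` controlled by the
mean of `‖u‖` over `(0, τ)`, plus an element of `X₁` controlled by `κ(τ)⁻¹` times the mean of `‖f‖`.
For `τ = κ⁻¹(r)` this bounds `K(r, u₀)` by the mean of `‖u‖ + ‖f‖` (`exists_decomposition`).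

Since `κ*(1/r) = κ⁻¹(r)`, the interpolation norm is comparable to a sum of `W(τ_n) K(r_n, u₀)^p`
along `r_n = l^n r₀`, `τ_n = κ⁻¹(r_n)`, with `r₀` so large that all `τ_n < T`. For `t ≤ r₀` the
bound `K(t, u₀) ≤ t ‖u₀‖` suffices (`lintegral_kFunctional_le`).

What remains is a weighted Hardy inequality for means over `(0, τ_n)`
(`tsum_weight_mul_average_le`). The `A_p` condition handles each piece `(τ_{n+1}, τ_n]`, and the
tail is absorbed: `τ_{n+1} ≤ (B/l) τ_n` while `W(τ_n) ≤ S(l) W(τ_{n+1})`, and `S(l) = o(l^p)` makes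
the product of losses small for one large `l`. -/

theorem le_mul_of_growthSup_le {φ : ℝ → ℝ} (hφ : ∀ t, 0 < t → 0 < φ t) {r c : ℝ} (hc : 0 ≤ c)
    (h : growthSup φ r ≤ ENNReal.ofReal c) {t : ℝ} (ht : 0 < t) : φ (r * t) ≤ c * φ t := by
  have h1 : ENNReal.ofReal (φ (r * t) / φ t) ≤ ENNReal.ofReal c :=
    (le_iSup₂ (f := fun (t : ℝ) (_ : 0 < t) => ENNReal.ofReal (φ (r * t) / φ t)) t ht).trans h
  rw [ENNReal.ofReal_le_ofReal_iff hc, div_le_iff₀ (hφ t ht)] at h1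
  exact h1

theorem Ioc_subset_iUnion_geometric {μ t : ℝ} (hμ : 0 < μ) (hμ' : μ < 1) (ht : 0 < t) :
    Ioc 0 t ⊆ ⋃ n : ℕ, Ioc (μ ^ (n + 1) * t) (μ ^ n * t) := by
  intro x hx
  obtain ⟨n, h1, h2⟩ := exists_nat_pow_near_of_lt_one (div_pos hx.1 ht)
    ((div_le_one ht).2 hx.2) hμ hμ'
  exact mem_iUnion.2 ⟨n, (lt_div_iff₀ ht).1 h1, (div_le_iff₀ ht).1 h2⟩

theorem Ioi_subset_iUnion_geometric {l t : ℝ} (hl : 1 < l) (ht : 0 < t) :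
    Ioi t ⊆ ⋃ n : ℕ, Ico (l ^ n * t) (l ^ (n + 1) * t) := by
  intro x hx
  obtain ⟨n, h1, h2⟩ := exists_nat_pow_near ((one_le_div ht).2 (le_of_lt hx)) hl
  exact mem_iUnion.2 ⟨n, (le_div_iff₀ ht).1 h1, (div_lt_iff₀ ht).1 h2⟩

/-! ### The kernel, its primitive and its generalized inverse. -/

section Kernel

variable {κ : ℝ → ℝ}

/-- This is the `o(r⁻¹)` condition at `0`: the product `t κ(t)` at least halves when `t` is scaled
by `μ`. -/
theorem exists_small_ratio (hκ : ClassIo (-1) 0 κ) :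
    ∃ μ : ℝ, 0 < μ ∧ μ < 1 / 2 ∧ ∀ t, 0 < t → κ (μ * t) ≤ 1 / (2 * μ) * κ t := by
  have h1 := hκ.2.1.eventually (gt_mem_nhds (show (0 : ℝ≥0∞) < ENNReal.ofReal (1 / 2) by simp))
  obtain ⟨μ, hμ, hμ0, hμ1⟩ := (h1.and (Ioo_mem_nhdsGT (show (0 : ℝ) < 1 / 2 by norm_num))).exists
  refine ⟨μ, hμ0, hμ1, fun t ht => le_mul_of_growthSup_le hκ.1 (by positivity) ?_ ht⟩
  have h2 : ENNReal.ofReal (μ ^ (-1 : ℝ)) ≠ 0 := by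
    simpa using Real.rpow_pos_of_pos hμ0 _
  rw [ENNReal.div_lt_iff (Or.inl h2) (Or.inl ENNReal.ofReal_ne_top),
    ← ENNReal.ofReal_mul (by norm_num), Real.rpow_neg_one] at hμ
  refine hμ.le.trans (le_of_eq ?_)
  congr 1
  field_simp

/-- Because `μ * (2 * t) ≤ t`, monotonicity turns the previous ratio into doubling. This stands in
for continuity when `κ (genInv κ r)` is compared with `r`. -/
theorem exists_doubling (hκ_anti : AntitoneOn κ (Ioi 0)) (hκ : ClassIo (-1) 0 κ) :
    ∃ D : ℝ, 1 ≤ D ∧ ∀ t, 0 < t → κ t ≤ D * κ (2 * t) := by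
  obtain ⟨μ, hμ0, hμ1, h⟩ := exists_small_ratio hκ
  refine ⟨1 / (2 * μ), ?_, fun t ht => ?_⟩
  · rw [le_div_iff₀ (by positivity)]; linarith
  · refine le_trans (hκ_anti (mem_Ioi.2 ?_) (mem_Ioi.2 ht) ?_) (h (2 * t) (by positivity))
    · positivity
    · nlinarith

/-- On `(μ^(n+1) t, μ^n t]` the length is at most `μ^n t` and `κ` is at most `(2μ)^(-(n+1)) κ(t)`,
so the pieces form a geometric series of ratio `1/2`. -/
theorem lintegral_kernel_le (hκ_anti : AntitoneOn κ (Ioi 0)) (hκ : ClassIo (-1) 0 κ) :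
    ∃ C : ℝ, 0 < C ∧ ∀ t, 0 < t →
      ∫⁻ s in Ioc 0 t, ENNReal.ofReal (κ s) ≤ ENNReal.ofReal (C * (t * κ t)) := by
  obtain ⟨μ, hμ0, hμ1, h⟩ := exists_small_ratio hκ
  refine ⟨1 / μ, by positivity, fun t ht => ?_⟩
  have hpow : ∀ n : ℕ, κ (μ ^ n * t) ≤ (1 / (2 * μ)) ^ n * κ t := by
    intro n
    induction n with
    | zero => simp
    | succ n ih =>
      calc κ (μ ^ (n + 1) * t) = κ (μ * (μ ^ n * t)) := by congr 1; ring
        _ ≤ 1 / (2 * μ) * κ (μ ^ n * t) := h _ (by positivity)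
        _ ≤ 1 / (2 * μ) * ((1 / (2 * μ)) ^ n * κ t) := by gcongr
        _ = _ := by ring
  have hκt := hκ.1 t ht
  calc ∫⁻ s in Ioc 0 t, ENNReal.ofReal (κ s)
      ≤ ∫⁻ s in ⋃ n : ℕ, Ioc (μ ^ (n + 1) * t) (μ ^ n * t), ENNReal.ofReal (κ s) :=
        lintegral_mono_set (Ioc_subset_iUnion_geometric hμ0 (by linarith) ht)
    _ ≤ ∑' n : ℕ, ∫⁻ s in Ioc (μ ^ (n + 1) * t) (μ ^ n * t), ENNReal.ofReal (κ s) :=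
        lintegral_iUnion_le _ _
    _ ≤ ∑' n : ℕ, ENNReal.ofReal ((1 / μ * (t * κ t) / 2) * (1 / 2) ^ n) := by
        refine ENNReal.tsum_le_tsum fun n => ?_
        have hb : ∀ s ∈ Ioc (μ ^ (n + 1) * t) (μ ^ n * t),
            ENNReal.ofReal (κ s) ≤ ENNReal.ofReal ((1 / (2 * μ)) ^ (n + 1) * κ t) := by
          intro s hs
          refine ENNReal.ofReal_le_ofReal (le_trans (hκ_anti ?_ ?_ hs.1.le) (hpow (n + 1)))
          · exact mem_Ioi.2 (by positivity)
          · exact mem_Ioi.2 (lt_trans (by positivity) hs.1)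
        refine (setLIntegral_mono' measurableSet_Ioc hb).trans ?_
        rw [setLIntegral_const, Real.volume_Ioc, ← ENNReal.ofReal_mul (by positivity)]
        refine ENNReal.ofReal_le_ofReal ?_
        calc (1 / (2 * μ)) ^ (n + 1) * κ t * (μ ^ n * t - μ ^ (n + 1) * t)
            ≤ (1 / (2 * μ)) ^ (n + 1) * κ t * (μ ^ n * t) := by
              gcongr
              have : 0 < μ ^ (n + 1) * t := by positivity
              linarith
          _ = _ := by
              rw [one_div, mul_inv, mul_pow, inv_pow μ, pow_succ μ, pow_succ]
              field_simp
    _ = ENNReal.ofReal (1 / μ * (t * κ t)) := by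
        have hs : HasSum (fun n : ℕ => (1 / μ * (t * κ t) / 2) * (1 / 2 : ℝ) ^ n)
            (1 / μ * (t * κ t) / 2 * 2) := hasSum_geometric_two.mul_left _
        rw [← ENNReal.ofReal_tsum_of_nonneg (fun n => by positivity) hs.summable, hs.tsum_eq]
        congr 1
        ring

theorem integrableOn_kernel (hκ_anti : AntitoneOn κ (Ioi 0)) (hκ : ClassIo (-1) 0 κ) (t : ℝ) :
    IntegrableOn κ (Ioc 0 t) := by
  rcases le_or_gt t 0 with ht | ht
  · simp [Ioc_eq_empty_of_le ht]
  obtain ⟨C, -, hC⟩ := lintegral_kernel_le hκ_anti hκ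
  refine ⟨(aemeasurable_restrict_of_antitoneOn measurableSet_Ioc
    (hκ_anti.mono Ioc_subset_Ioi_self)).aestronglyMeasurable, ?_⟩
  have h1 : ∫⁻ s in Ioc 0 t, ‖κ s‖ₑ = ∫⁻ s in Ioc 0 t, ENNReal.ofReal (κ s) :=
    setLIntegral_congr_fun measurableSet_Ioc fun s hs => by
      rw [Real.enorm_of_nonneg (hκ.1 s hs.1).le]
  rw [HasFiniteIntegral, h1]
  exact (hC t ht).trans_lt ENNReal.ofReal_lt_top

theorem integral_kernel_le (hκ_anti : AntitoneOn κ (Ioi 0)) (hκ : ClassIo (-1) 0 κ) :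
    ∃ C : ℝ, 0 < C ∧ ∀ t, 0 < t → ∫ s in (0 : ℝ)..t, κ s ≤ C * (t * κ t) := by
  obtain ⟨C, hC0, hC⟩ := lintegral_kernel_le hκ_anti hκ
  refine ⟨C, hC0, fun t ht => ?_⟩
  have hκt := hκ.1 t ht
  rw [intervalIntegral.integral_of_le ht.le, integral_eq_lintegral_of_nonneg_ae
    ((ae_restrict_iff' measurableSet_Ioc).2 (ae_of_all _ fun s hs => (hκ.1 s hs.1).le))
    (integrableOn_kernel hκ_anti hκ t).1]
  exact ENNReal.toReal_le_of_le_ofReal (by positivity) (hC t ht)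

theorem mul_kernel_le_integral (hκ_anti : AntitoneOn κ (Ioi 0)) (hκ : ClassIo (-1) 0 κ)
    {x t : ℝ} (hx : 0 ≤ x) (hxt : x ≤ t) (ht : 0 < t) :
    x * κ t ≤ ∫ s in (0 : ℝ)..x, κ s := by
  have h1 : ∫ s in (0 : ℝ)..x, κ t ≤ ∫ s in (0 : ℝ)..x, κ s := by
    refine intervalIntegral.integral_mono_on_of_le_Ioo hx (by simp)
      ((intervalIntegrable_iff_integrableOn_Ioc_of_le hx).2 (integrableOn_kernel hκ_anti hκ x)) ?_
    intro s hs
    exact hκ_anti hs.1 ht (hs.2.le.trans hxt)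
  simpa using h1

theorem integral_kernel_mono (hκ_anti : AntitoneOn κ (Ioi 0)) (hκ : ClassIo (-1) 0 κ)
    {x t : ℝ} (hx : 0 ≤ x) (hxt : x ≤ t) :
    ∫ s in (0 : ℝ)..x, κ s ≤ ∫ s in (0 : ℝ)..t, κ s := by
  rw [intervalIntegral.integral_of_le hx, intervalIntegral.integral_of_le (hx.trans hxt)]
  exact setIntegral_mono_set (integrableOn_kernel hκ_anti hκ t)
    ((ae_restrict_iff' measurableSet_Ioc).2 (ae_of_all _ fun s hs => (hκ.1 s hs.1).le))
    (Ioc_subset_Ioc_right hxt).eventuallyLE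

theorem exists_kernel_le_small (hκ : ClassIo (-1) 0 κ) {ε : ℝ} (hε : 0 < ε) :
    ∃ l : ℝ, 0 < l ∧ ∀ t, 0 < t → κ (l * t) ≤ ε * κ t := by
  have h1 := hκ.2.2.eventually (gt_mem_nhds (ENNReal.ofReal_pos.2 hε))
  obtain ⟨l, hl, hl0⟩ := (h1.and (eventually_gt_atTop 0)).exists
  refine ⟨l, hl0, fun t ht => le_mul_of_growthSup_le hκ.1 hε.le ?_ ht⟩
  simpa using hl.le

theorem exists_kernel_le (hκ : ClassIo (-1) 0 κ) {r : ℝ} (hr : 0 < r) :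
    ∃ s, 0 < s ∧ κ s ≤ r := by
  have h1 := hκ.1 1 one_pos
  obtain ⟨l, hl, h⟩ := exists_kernel_le_small hκ (div_pos hr h1)
  refine ⟨l * 1, by simpa using hl, (h 1 one_pos).trans (le_of_eq (by field_simp))⟩

/-- Decay at infinity read backwards: `κ 1` is a small multiple of `κ l⁻¹`, which must then be
large. -/
theorem exists_lt_kernel (hκ : ClassIo (-1) 0 κ) {r : ℝ} (hr : 0 < r) :
    ∃ s, 0 < s ∧ r < κ s := by
  have h1 := hκ.1 1 one_pos
  obtain ⟨l, hl, h⟩ := exists_kernel_le_small hκ (div_pos h1 (mul_pos two_pos hr))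
  refine ⟨l⁻¹, inv_pos.2 hl, ?_⟩
  have h2 := h l⁻¹ (inv_pos.2 hl)
  rw [mul_inv_cancel₀ hl.ne', div_mul_eq_mul_div, le_div_iff₀ (by positivity)] at h2
  nlinarith

theorem bddBelow_genInv (κ : ℝ → ℝ) (r : ℝ) : BddBelow {s : ℝ | 0 < s ∧ κ s ≤ r} :=
  ⟨0, fun _ hs => hs.1.le⟩

theorem lt_kernel_of_lt_genInv {r s : ℝ} (hs : 0 < s) (h : s < genInv κ r) : r < κ s := by
  by_contra! h'
  exact absurd (csInf_le (bddBelow_genInv κ r) ⟨hs, h'⟩) (not_le.2 h)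

theorem genInv_pos (hκ_anti : AntitoneOn κ (Ioi 0)) (hκ : ClassIo (-1) 0 κ) {r : ℝ}
    (hr : 0 < r) : 0 < genInv κ r := by
  obtain ⟨s, hs, hrs⟩ := exists_lt_kernel hκ hr
  refine hs.trans_le (le_csInf (exists_kernel_le hκ hr) fun x hx => ?_)
  by_contra! h
  exact absurd (hκ_anti hx.1 hs h.le) (not_le.2 (hx.2.trans_lt hrs))

theorem kernel_le_of_genInv_lt (hκ_anti : AntitoneOn κ (Ioi 0)) (hκ : ClassIo (-1) 0 κ)
    {r s : ℝ} (hr : 0 < r) (h : genInv κ r < s) : κ s ≤ r := by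
  obtain ⟨x, hx, hxs⟩ := exists_lt_of_csInf_lt (exists_kernel_le hκ hr) h
  exact (hκ_anti hx.1 (hx.1.trans hxs) hxs.le).trans hx.2

theorem genInv_anti (hκ : ClassIo (-1) 0 κ) {r r' : ℝ} (hr : 0 < r) (h : r ≤ r') :
    genInv κ r' ≤ genInv κ r :=
  csInf_le_csInf (bddBelow_genInv κ r') (exists_kernel_le hκ hr) fun _ hs => ⟨hs.1, hs.2.trans h⟩

theorem exists_genInv_lt (hκ : ClassIo (-1) 0 κ) {T : ℝ} (hT : 0 < T) :
    ∃ r, 0 < r ∧ genInv κ r < T :=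
  ⟨κ (T / 2), hκ.1 _ (half_pos hT),
    (csInf_le (bddBelow_genInv κ _) ⟨half_pos hT, le_rfl⟩).trans_lt (half_lt_self hT)⟩

/-- A jump of `κ` at `τ = genInv κ r` is harmless: `κ` exceeds `r` at `τ / 2`, and doubling carries
this to `τ`. The next lemma uses `2 * τ` in the same way. -/
theorem le_mul_kernel_genInv (hκ_anti : AntitoneOn κ (Ioi 0)) (hκ : ClassIo (-1) 0 κ) {D : ℝ}
    (hD : ∀ t, 0 < t → κ t ≤ D * κ (2 * t)) {r : ℝ} (hr : 0 < r) : r ≤ D * κ (genInv κ r) := by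
  have h0 := genInv_pos hκ_anti hκ hr
  have h1 := hD _ (half_pos h0)
  rw [mul_div_cancel₀ _ two_ne_zero] at h1
  exact (lt_kernel_of_lt_genInv (half_pos h0) (half_lt_self h0)).le.trans h1

theorem kernel_genInv_le (hκ_anti : AntitoneOn κ (Ioi 0)) (hκ : ClassIo (-1) 0 κ) {D : ℝ}
    (hD1 : 1 ≤ D) (hD : ∀ t, 0 < t → κ t ≤ D * κ (2 * t)) {r : ℝ} (hr : 0 < r) :
    κ (genInv κ r) ≤ D * r := by
  have h0 := genInv_pos hκ_anti hκ hr
  refine (hD _ h0).trans ?_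
  gcongr
  exact kernel_le_of_genInv_lt hκ_anti hκ hr (by linarith)

/-- Since `x κ(x) ≤ ∫_0^x κ ≤ C x κ(x)`, the function `x κ(x)` is increasing up to a constant.
Comparing its values at `κ⁻¹(l r)` and `κ⁻¹(r)`, where `κ` is about `l r` and `r`, gives the rate `1
/ l`. -/
theorem exists_genInv_mul_le (hκ_anti : AntitoneOn κ (Ioi 0)) (hκ : ClassIo (-1) 0 κ) :
    ∃ B : ℝ, 0 < B ∧ ∀ l r, 1 ≤ l → 0 < r → genInv κ (l * r) ≤ B / l * genInv κ r := by
  obtain ⟨D, hD1, hD⟩ := exists_doubling hκ_anti hκ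
  obtain ⟨C, hC0, hC⟩ := integral_kernel_le hκ_anti hκ
  refine ⟨C * D ^ 2, by positivity, fun l r hl hr => ?_⟩
  have hlr : 0 < l * r := by positivity
  have hs := genInv_pos hκ_anti hκ hlr
  have ht := genInv_pos hκ_anti hκ hr
  have hst := genInv_anti hκ hr (show r ≤ l * r by nlinarith)
  set s := genInv κ (l * r)
  set t := genInv κ r
  have h1 : s * κ s ≤ C * (t * κ t) :=
    (mul_kernel_le_integral hκ_anti hκ hs.le le_rfl hs).trans
      ((integral_kernel_mono hκ_anti hκ hs.le hst).trans (hC t ht))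
  have h2 : l * r ≤ D * κ s := le_mul_kernel_genInv hκ_anti hκ hD hlr
  have h3 : κ t ≤ D * r := kernel_genInv_le hκ_anti hκ hD1 hD hr
  have h4 : s * (l * r) ≤ C * D ^ 2 * t * r :=
    calc s * (l * r) ≤ s * (D * κ s) := by gcongr
      _ = D * (s * κ s) := by ring
      _ ≤ D * (C * (t * (D * r))) := by
        refine mul_le_mul_of_nonneg_left (h1.trans ?_) (by linarith)
        gcongr
      _ = _ := by ring
  have h5 : s * l ≤ C * D ^ 2 * t := by
    refine le_of_mul_le_mul_right ?_ hr
    linarith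
  rw [div_mul_eq_mul_div, le_div_iff₀ (by linarith)]
  exact h5

end Kernel

/-! ### Muckenhoupt weights on `(0, τ]`. -/

theorem lintegral_mul_rpow_le_apConst {p : ℝ} (hp : 1 < p) (w : ℝ → ℝ≥0) {τ : ℝ} (hτ : 0 < τ) :
    (∫⁻ t in Ioc 0 τ, (w t : ℝ≥0∞)) *
        (∫⁻ t in Ioc 0 τ, (w t : ℝ≥0∞) ^ (-(1 / (p - 1)))) ^ (p - 1) ≤
      apConst p w * ENNReal.ofReal τ ^ p := by
  have h1 : _ ≤ apConst p w := le_iSup_of_le (0 : ℝ) (le_iSup_of_le τ (le_iSup_of_le hτ le_rfl))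
  have hτ0 : ENNReal.ofReal τ ≠ 0 := by simpa using hτ
  have hτt : ENNReal.ofReal τ ≠ ∞ := ENNReal.ofReal_ne_top
  rw [← setLIntegral_congr Ioc_ae_eq_Icc, ← setLIntegral_congr Ioc_ae_eq_Icc, sub_zero,
    ENNReal.div_rpow_of_nonneg _ _ (by linarith)] at h1
  have h2 : ENNReal.ofReal τ ^ p = ENNReal.ofReal τ * ENNReal.ofReal τ ^ (p - 1) := by
    conv_rhs => rw [← ENNReal.rpow_one (ENNReal.ofReal τ)]
    rw [← ENNReal.rpow_mul, one_mul, ← ENNReal.rpow_add _ _ hτ0 hτt]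
    congr 1; ring
  have h3 : ENNReal.ofReal τ ^ (p - 1) ≠ 0 := (ENNReal.rpow_pos (pos_iff_ne_zero.2 hτ0) hτt).ne'
  have h4 : ENNReal.ofReal τ ^ (p - 1) ≠ ∞ := ENNReal.rpow_ne_top_of_nonneg (by linarith) hτt
  generalize (∫⁻ t in Ioc 0 τ, (w t : ℝ≥0∞) ^ (-(1 / (p - 1)))) ^ (p - 1) = V at h1 ⊢
  generalize ∫⁻ t in Ioc 0 τ, (w t : ℝ≥0∞) = U at h1 ⊢
  calc U * V = (U / ENNReal.ofReal τ * ENNReal.ofReal τ) *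
        (V / ENNReal.ofReal τ ^ (p - 1) * ENNReal.ofReal τ ^ (p - 1)) := by
        rw [ENNReal.div_mul_cancel hτ0 hτt, ENNReal.div_mul_cancel h3 h4]
    _ = U / ENNReal.ofReal τ * (V / ENNReal.ofReal τ ^ (p - 1)) * ENNReal.ofReal τ ^ p := by
        rw [h2]; ring
    _ ≤ apConst p w * ENNReal.ofReal τ ^ p := mul_le_mul' h1 le_rfl

theorem lintegral_dual_weight_ne_top {p : ℝ} (hp : 1 < p) {w : ℝ → ℝ≥0} (hA : apConst p w ≠ ∞)
    {τ : ℝ} (hτ : 0 < τ) (hW : ∫⁻ t in Ioc 0 τ, (w t : ℝ≥0∞) ≠ 0) :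
    ∫⁻ t in Ioc 0 τ, (w t : ℝ≥0∞) ^ (-(1 / (p - 1))) ≠ ∞ := by
  intro h
  have h1 := lintegral_mul_rpow_le_apConst hp w hτ
  rw [h, ENNReal.top_rpow_of_pos (by linarith), ENNReal.mul_top hW, top_le_iff] at h1
  exact ENNReal.mul_ne_top hA
    (ENNReal.rpow_ne_top_of_nonneg (by linarith) ENNReal.ofReal_ne_top) h1

/-- The dual weight is `∞` where `w = 0` and has finite integral. Hence one may divide by `w`, and
Lebesgue measure is absolutely continuous with respect to `w dt`. -/
theorem ae_weight_ne_zero {p : ℝ} (hp : 1 < p) {w : ℝ → ℝ≥0} (hw : Measurable w)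
    (hA : apConst p w ≠ ∞) {τ : ℝ} (hτ : 0 < τ) (hW : ∫⁻ t in Ioc 0 τ, (w t : ℝ≥0∞) ≠ 0) :
    ∀ᵐ t ∂(volume.restrict (Ioc 0 τ)), (w t : ℝ≥0∞) ≠ 0 := by
  have hm : Measurable fun t => (w t : ℝ≥0∞) ^ (-(1 / (p - 1))) := by fun_prop
  filter_upwards [ae_lt_top hm (lintegral_dual_weight_ne_top hp hA hτ hW)] with t ht h0
  rw [h0, ENNReal.zero_rpow_of_neg (neg_neg_of_pos (one_div_pos.2 (by linarith)))] at ht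
  exact lt_irrefl _ ht

/-- Hölder's inequality for a Muckenhoupt weight. -/
theorem lintegral_mul_rpow_lintegral_le {p : ℝ} (hp : 1 < p) {w : ℝ → ℝ≥0} (hw : Measurable w)
    (hA : apConst p w ≠ ∞) {τ : ℝ} (hτ : 0 < τ) (hW : ∫⁻ t in Ioc 0 τ, (w t : ℝ≥0∞) ≠ 0)
    {A : Set ℝ} (hAτ : A ⊆ Ioc 0 τ) {g : ℝ → ℝ≥0∞}
    (hg : AEMeasurable g (volume.restrict (Ioc 0 τ))) :
    (∫⁻ t in Ioc 0 τ, (w t : ℝ≥0∞)) * (∫⁻ t in A, g t) ^ p ≤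
      apConst p w * ENNReal.ofReal τ ^ p * ∫⁻ t in A, g t ^ p * w t := by
  have hp0 : 0 < p := by linarith
  have hp1 : 0 < p - 1 := by linarith
  have hwt : Measurable fun t => (w t : ℝ≥0∞) := by fun_prop
  have hgA : AEMeasurable g (volume.restrict A) := hg.mono_measure (Measure.restrict_mono_set _ hAτ)
  have hpq : p.HolderConjugate (p / (p - 1)) := Real.HolderConjugate.conjExponent hp
  have h1 : ∫⁻ t in A, g t =
      ∫⁻ t in A, ((fun t => g t * (w t : ℝ≥0∞) ^ (1 / p)) *
        fun t => (w t : ℝ≥0∞) ^ (-(1 / p))) t := by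
    refine lintegral_congr_ae ?_
    filter_upwards [ae_mono (Measure.restrict_mono_set _ hAτ)
      (ae_weight_ne_zero hp hw hA hτ hW)] with t ht
    rw [Pi.mul_apply, mul_assoc, ← ENNReal.rpow_add _ _ ht ENNReal.coe_ne_top]
    simp
  have h2 : ∫⁻ t in A, ((fun t => g t * (w t : ℝ≥0∞) ^ (1 / p)) *
        fun t => (w t : ℝ≥0∞) ^ (-(1 / p))) t ≤
      (∫⁻ t in A, (g t * (w t : ℝ≥0∞) ^ (1 / p)) ^ p) ^ (1 / p) *
        (∫⁻ t in A, ((w t : ℝ≥0∞) ^ (-(1 / p))) ^ (p / (p - 1))) ^ (1 / (p / (p - 1))) :=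
    ENNReal.lintegral_mul_le_Lp_mul_Lq (volume.restrict A) hpq
    (hgA.mul (hwt.pow_const (1 / p)).aemeasurable) (hwt.pow_const (-(1 / p))).aemeasurable
  have h3 : ∀ t, (g t * (w t : ℝ≥0∞) ^ (1 / p)) ^ p = g t ^ p * w t := fun t => by
    rw [ENNReal.mul_rpow_of_nonneg _ _ hp0.le, ← ENNReal.rpow_mul, one_div_mul_cancel hp0.ne',
      ENNReal.rpow_one]
  have h4 : ∀ t, ((w t : ℝ≥0∞) ^ (-(1 / p))) ^ (p / (p - 1)) =
      (w t : ℝ≥0∞) ^ (-(1 / (p - 1))) := fun t => by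
    rw [← ENNReal.rpow_mul]
    congr 1
    field_simp
  simp only [h3, h4] at h2
  calc (∫⁻ t in Ioc 0 τ, (w t : ℝ≥0∞)) * (∫⁻ t in A, g t) ^ p
      ≤ (∫⁻ t in Ioc 0 τ, (w t : ℝ≥0∞)) * ((∫⁻ t in A, g t ^ p * w t) ^ (1 / p) *
        (∫⁻ t in A, (w t : ℝ≥0∞) ^ (-(1 / (p - 1)))) ^ (1 / (p / (p - 1)))) ^ p := by
        rw [h1]; gcongr
    _ = (∫⁻ t in Ioc 0 τ, (w t : ℝ≥0∞)) *
        (∫⁻ t in A, (w t : ℝ≥0∞) ^ (-(1 / (p - 1)))) ^ (p - 1) * ∫⁻ t in A, g t ^ p * w t := by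
        rw [ENNReal.mul_rpow_of_nonneg _ _ hp0.le, ← ENNReal.rpow_mul, ← ENNReal.rpow_mul,
          one_div_mul_cancel hp0.ne', ENNReal.rpow_one,
          show 1 / (p / (p - 1)) * p = p - 1 by field_simp]
        ring
    -- Only the dual weight is enlarged to `Ioc 0 τ`; `g` stays on `A`, so disjoint sets `A` can be
    -- summed later.
    _ ≤ (∫⁻ t in Ioc 0 τ, (w t : ℝ≥0∞)) *
        (∫⁻ t in Ioc 0 τ, (w t : ℝ≥0∞) ^ (-(1 / (p - 1)))) ^ (p - 1) *
          ∫⁻ t in A, g t ^ p * w t := by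
        gcongr
    _ ≤ _ := mul_le_mul' (lintegral_mul_rpow_le_apConst hp w hτ) le_rfl

theorem mul_div_rpow_lintegral_le {p : ℝ} (hp : 1 < p) {w : ℝ → ℝ≥0} (hw : Measurable w)
    (hA : apConst p w ≠ ∞) {τ : ℝ} (hτ : 0 < τ) (hW : ∫⁻ t in Ioc 0 τ, (w t : ℝ≥0∞) ≠ 0)
    {A : Set ℝ} (hAτ : A ⊆ Ioc 0 τ) {g : ℝ → ℝ≥0∞}
    (hg : AEMeasurable g (volume.restrict (Ioc 0 τ))) :
    (∫⁻ t in Ioc 0 τ, (w t : ℝ≥0∞)) * ((∫⁻ t in A, g t) / ENNReal.ofReal τ) ^ p ≤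
      apConst p w * ∫⁻ t in A, g t ^ p * w t := by
  have hp0 : 0 < p := by linarith
  have hτ0 : 0 < ENNReal.ofReal τ := by simpa using hτ
  rw [ENNReal.div_rpow_of_nonneg _ _ hp0.le, ← mul_div_assoc]
  refine ENNReal.div_le_of_le_mul' ?_
  refine (lintegral_mul_rpow_lintegral_le hp hw hA hτ hW hAτ hg).trans (le_of_eq ?_)
  ring

/-! ### The discrete Hardy inequality. -/

/-- A partial sum `Q` satisfies `Q ≤ ∑ P + (Q + B) / 2`, and `Q` is absorbed on the left. The bound
`B` serves twice: it makes `Q` finite and pays for the term `H N` created by the shift. -/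
theorem tsum_le_of_le_half_succ_add {H P : ℕ → ℝ≥0∞} {B : ℝ≥0∞} (hB : B ≠ ∞)
    (hH : ∀ n, H n ≤ P n + H (n + 1) / 2) (hHB : ∀ n, H n ≤ B) :
    ∑' n, H n ≤ 2 * (∑' n, P n) + B := by
  rw [ENNReal.tsum_eq_iSup_nat]
  refine iSup_le fun N => ?_
  have hfin : ∑ n ∈ Finset.range N, H n ≠ ∞ :=
    ENNReal.sum_ne_top.2 fun n _ => ne_top_of_le_ne_top hB (hHB n)
  have h1 : ∑ n ∈ Finset.range N, H n ≤
      ∑' n, P n + (∑ n ∈ Finset.range N, H n + B) / 2 := by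
    calc ∑ n ∈ Finset.range N, H n
        ≤ ∑ n ∈ Finset.range N, (P n + H (n + 1) / 2) := Finset.sum_le_sum fun n _ => hH n
      _ = ∑ n ∈ Finset.range N, P n + (∑ n ∈ Finset.range N, H (n + 1)) / 2 := by
          rw [Finset.sum_add_distrib]
          simp only [div_eq_mul_inv, Finset.sum_mul]
      _ ≤ _ := by
          gcongr
          · exact ENNReal.sum_le_tsum _
          · calc ∑ n ∈ Finset.range N, H (n + 1)
                ≤ ∑ n ∈ Finset.range N, H (n + 1) + H 0 := le_self_add
              _ = ∑ n ∈ Finset.range N, H n + H N := by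
                  rw [← Finset.sum_range_succ', Finset.sum_range_succ]
              _ ≤ _ := by gcongr; exact hHB N
  set Q := ∑ n ∈ Finset.range N, H n
  have h2 : Q + Q ≤ (2 * (∑' n, P n) + B) + Q := by
    calc Q + Q = 2 * Q := (two_mul Q).symm
      _ ≤ 2 * (∑' n, P n + (Q + B) / 2) := by gcongr
      _ = 2 * (∑' n, P n) + (Q + B) := by
          rw [mul_add, ENNReal.mul_div_cancel (by norm_num) (by norm_num)]
      _ = _ := by ring
  exact (ENNReal.add_le_add_iff_right hfin).1 h2

/-- A discrete weighted Hardy inequality along a sequence of times. -/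
theorem tsum_weight_mul_average_le {p : ℝ} (hp : 1 < p) {w : ℝ → ℝ≥0} (hw : Measurable w)
    (hA : apConst p w ≠ ∞) {τ : ℕ → ℝ} (hτ : ∀ n, 0 < τ n) (hanti : Antitone τ)
    (hW : ∀ n, ∫⁻ t in Ioc 0 (τ n), (w t : ℝ≥0∞) ≠ 0) {s b : ℝ≥0∞}
    (hWs : ∀ n, ∫⁻ t in Ioc 0 (τ n), (w t : ℝ≥0∞) ≤ s * ∫⁻ t in Ioc 0 (τ (n + 1)), (w t : ℝ≥0∞))
    (hτb : ∀ n, ENNReal.ofReal (τ (n + 1)) ≤ b * ENNReal.ofReal (τ n))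
    (hsb : 2 ^ (p - 1) * (s * b ^ p) ≤ 2⁻¹) {g : ℝ → ℝ≥0∞}
    (hg : AEMeasurable g (volume.restrict (Ioc 0 (τ 0))))
    (hG : ∫⁻ t in Ioc 0 (τ 0), g t ^ p * w t ≠ ∞) :
    ∑' n, (∫⁻ t in Ioc 0 (τ n), (w t : ℝ≥0∞)) *
        ((∫⁻ t in Ioc 0 (τ n), g t) / ENNReal.ofReal (τ n)) ^ p ≤
      (2 * 2 ^ (p - 1) + 1) * apConst p w * ∫⁻ t in Ioc 0 (τ 0), g t ^ p * w t := by
  have hp0 : 0 < p := by linarith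
  have hsub : ∀ n, Ioc 0 (τ n) ⊆ Ioc 0 (τ 0) := fun n =>
    Ioc_subset_Ioc_right (hanti (Nat.zero_le n))
  have hg' : ∀ n, AEMeasurable g (volume.restrict (Ioc 0 (τ n))) := fun n =>
    hg.mono_measure (Measure.restrict_mono_set _ (hsub n))
  have hsub' : ∀ n, Ioc (τ (n + 1)) (τ n) ⊆ Ioc 0 (τ n) := fun n =>
    Ioc_subset_Ioc_left (hτ (n + 1)).le
  set G := ∫⁻ t in Ioc 0 (τ 0), g t ^ p * w t 
  have hP : ∑' n, 2 ^ (p - 1) * (apConst p w * ∫⁻ t in Ioc (τ (n + 1)) (τ n), g t ^ p * w t) ≤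
      2 ^ (p - 1) * (apConst p w * G) := by
    rw [ENNReal.tsum_mul_left, ENNReal.tsum_mul_left,
      ← lintegral_iUnion (s := fun n => Ioc (τ (n + 1)) (τ n)) (fun n => measurableSet_Ioc) hanti.pairwise_disjoint_on_Ioc_succ]
    gcongr
    exact lintegral_mono_set (iUnion_subset fun n => (hsub' n).trans (hsub n))
  -- `P n` is the contribution of `(τ (n + 1), τ n]`; the part of the mean coming from `(0, τ (n +
  -- 1)]` costs `2^(p-1) s b^p ≤ 1/2` times the next term.
  refine (tsum_le_of_le_half_succ_add (B := apConst p w * G)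
    (P := fun n => 2 ^ (p - 1) * (apConst p w * ∫⁻ t in Ioc (τ (n + 1)) (τ n), g t ^ p * w t))
    (ENNReal.mul_ne_top hA hG) (fun n => ?_) (fun n => ?_)).trans ?_
  · set X := ∫⁻ t in Ioc 0 (τ (n + 1)), g t
    have hX : X / ENNReal.ofReal (τ n) ≤ b * (X / ENNReal.ofReal (τ (n + 1))) := by
      have h0 : ENNReal.ofReal (τ (n + 1)) ≠ 0 := by simpa using hτ (n + 1)
      refine ENNReal.div_le_of_le_mul ?_
      calc X = X / ENNReal.ofReal (τ (n + 1)) * ENNReal.ofReal (τ (n + 1)) :=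
            (ENNReal.div_mul_cancel h0 ENNReal.ofReal_ne_top).symm
        _ ≤ X / ENNReal.ofReal (τ (n + 1)) * (b * ENNReal.ofReal (τ n)) := by
            gcongr; exact hτb n
        _ = _ := by ring
    have hsplit : ∫⁻ t in Ioc 0 (τ n), g t = (∫⁻ t in Ioc (τ (n + 1)) (τ n), g t) + X := by
      rw [← Ioc_union_Ioc_eq_Ioc (hτ (n + 1)).le (hanti n.le_succ),
        lintegral_union measurableSet_Ioc (Ioc_disjoint_Ioc_of_le le_rfl), add_comm]
    set Wn := ∫⁻ t in Ioc 0 (τ n), (w t : ℝ≥0∞)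
    set Wm := ∫⁻ t in Ioc 0 (τ (n + 1)), (w t : ℝ≥0∞)
    rw [hsplit, ENNReal.add_div]
    calc Wn * ((∫⁻ t in Ioc (τ (n + 1)) (τ n), g t) / ENNReal.ofReal (τ n) +
          X / ENNReal.ofReal (τ n)) ^ p
        ≤ Wn * (2 ^ (p - 1) * (((∫⁻ t in Ioc (τ (n + 1)) (τ n), g t) / ENNReal.ofReal (τ n)) ^ p +
          (X / ENNReal.ofReal (τ n)) ^ p)) := by
          gcongr; exact ENNReal.rpow_add_le_mul_rpow_add_rpow _ _ hp.le
      _ = 2 ^ (p - 1) * (Wn * ((∫⁻ t in Ioc (τ (n + 1)) (τ n), g t) / ENNReal.ofReal (τ n)) ^ p) +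
          2 ^ (p - 1) * (Wn * (X / ENNReal.ofReal (τ n)) ^ p) := by ring
      _ ≤ 2 ^ (p - 1) * (apConst p w * ∫⁻ t in Ioc (τ (n + 1)) (τ n), g t ^ p * w t) +
          2 ^ (p - 1) * ((s * Wm) * (b * (X / ENNReal.ofReal (τ (n + 1)))) ^ p) := by
          refine add_le_add (mul_le_mul' le_rfl
            (mul_div_rpow_lintegral_le hp hw hA (hτ n) (hW n) (hsub' n) (hg' n)))
            (mul_le_mul' le_rfl (mul_le_mul' (hWs n) ?_))
          gcongr
      _ = 2 ^ (p - 1) * (apConst p w * ∫⁻ t in Ioc (τ (n + 1)) (τ n), g t ^ p * w t) +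
          (2 ^ (p - 1) * (s * b ^ p)) * (Wm * (X / ENNReal.ofReal (τ (n + 1))) ^ p) := by
          rw [ENNReal.mul_rpow_of_nonneg _ _ hp0.le]; ring
      _ ≤ _ := by
          rw [ENNReal.div_eq_inv_mul (b := 2)]
          gcongr
  · refine (mul_div_rpow_lintegral_le hp hw hA (hτ n) (hW n) subset_rfl (hg' n)).trans ?_
    exact mul_le_mul' le_rfl (lintegral_mono_set (hsub n))
  · calc _ ≤ 2 * (2 ^ (p - 1) * (apConst p w * G)) + apConst p w * G := by gcongr
      _ = _ := by ring

/-! ### Integrating the equation and splitting the initial value. -/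

/-- Fubini: extending `k` and `v` by zero encodes the triangle `0 < s < t ≤ τ`, and integrability is
that of a convolution integrand of two integrable functions. -/
theorem integral_integral_convolution {E : Type*} [NormedAddCommGroup E] [NormedSpace ℝ E]
    [CompleteSpace E] {k : ℝ → ℝ} {v : ℝ → E} {τ : ℝ} (hτ : 0 ≤ τ)
    (hk : IntegrableOn k (Ioc 0 τ)) (hv : IntegrableOn v (Ioc 0 τ)) :
    ∫ t in (0 : ℝ)..τ, ∫ s in (0 : ℝ)..t, k (t - s) • v s =
      ∫ s in (0 : ℝ)..τ, (∫ x in (0 : ℝ)..(τ - s), k x) • v s := by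
  set k' := (Ioc 0 τ).indicator k with hk'
  set v' := (Ioc 0 τ).indicator v with hv'
  have hk1 : Integrable k' := (integrable_indicator_iff measurableSet_Ioc).2 hk
  have hv1 : Integrable v' := (integrable_indicator_iff measurableSet_Ioc).2 hv
  have hint : Integrable (Function.uncurry fun t s : ℝ => k' (t - s) • v' s)
      ((volume.restrict (Ioc 0 τ)).prod volume) := by
    have h1 := hv1.convolution_integrand (ContinuousLinearMap.lsmul ℝ ℝ).flip hk1
    have h2 : (volume.restrict (Ioc 0 τ)).prod (volume : Measure ℝ) =
        (volume.prod volume).restrict (Ioc 0 τ ×ˢ univ) := by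
      rw [← Measure.prod_restrict, Measure.restrict_univ]
    rw [h2]
    exact h1.restrict
  rw [intervalIntegral.integral_of_le hτ, intervalIntegral.integral_of_le hτ]
  calc ∫ t in Ioc 0 τ, ∫ s in (0 : ℝ)..t, k (t - s) • v s
      = ∫ t in Ioc 0 τ, ∫ s, k' (t - s) • v' s := by
        refine setIntegral_congr_fun measurableSet_Ioc fun t ht => ?_
        -- The endpoint `s = t` is dropped because the extended kernel vanishes at `0`.
        rw [intervalIntegral.integral_of_le ht.1.le, integral_Ioc_eq_integral_Ioo,
          ← integral_indicator measurableSet_Ioo]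
        congr 1
        ext s
        by_cases hs : s ∈ Ioo 0 t
        · rw [indicator_of_mem hs, hk', hv', indicator_of_mem, indicator_of_mem]
          · exact ⟨hs.1, hs.2.le.trans ht.2⟩
          · exact ⟨by linarith [hs.2], by linarith [hs.1, ht.2]⟩
        · rw [indicator_of_notMem hs]
          by_cases h0 : 0 < s
          · rw [hk', indicator_of_notMem, zero_smul]
            exact fun h => hs ⟨h0, by linarith [h.1]⟩
          · rw [hv', indicator_of_notMem, smul_zero]
            exact fun h => h0 h.1
    _ = ∫ s, ∫ t in Ioc 0 τ, k' (t - s) • v' s := integral_integral_swap hint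
    _ = ∫ s in Ioc 0 τ, (∫ x in (0 : ℝ)..(τ - s), k x) • v s := by
        rw [← integral_indicator measurableSet_Ioc]
        congr 1
        ext s
        rw [integral_smul_const]
        by_cases hs : s ∈ Ioc 0 τ
        · rw [indicator_of_mem hs, hv', indicator_of_mem hs,
            intervalIntegral.integral_of_le (sub_nonneg.2 hs.2),
            ← integral_indicator measurableSet_Ioc, ← integral_indicator measurableSet_Ioc,
            ← integral_sub_right_eq_self ((Ioc 0 (τ - s)).indicator k) s]
          congr 2
          ext t
          by_cases ht : t - s ∈ Ioc 0 (τ - s)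
          · rw [indicator_of_mem ht, indicator_of_mem, hk', indicator_of_mem]
            · exact ⟨ht.1, by linarith [ht.2, hs.1]⟩
            · exact ⟨by linarith [ht.1, hs.1], by linarith [ht.2]⟩
          · rw [indicator_of_notMem ht]
            by_cases h0 : t ∈ Ioc 0 τ
            · rw [indicator_of_mem h0, hk', indicator_of_notMem]
              exact fun h => ht ⟨h.1, by linarith [h0.2]⟩
            · rw [indicator_of_notMem h0]
        · rw [indicator_of_notMem hs, hv', indicator_of_notMem hs, smul_zero]

/-- A splitting of the initial value into averages of the solution and of the forcing. -/
theorem exists_decomposition {κ : ℝ → ℝ} (hκ_anti : AntitoneOn κ (Ioi 0))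
    (hκ : ClassIo (-1) 0 κ) :
    ∃ c : ℝ, 0 < c ∧ ∀ (X₀ : Type*) (X₁ : Type*)
      [NormedAddCommGroup X₀] [NormedSpace ℝ X₀] [CompleteSpace X₀]
      [NormedAddCommGroup X₁] [NormedSpace ℝ X₁] [CompleteSpace X₁]
      (ι : X₀ →L[ℝ] X₁) (u : ℝ → X₀) (f : ℝ → X₁) (u₀ : X₁) (r : ℝ), 0 < r →
      IntegrableOn u (Ioc 0 (genInv κ r)) → IntegrableOn f (Ioc 0 (genInv κ r)) →
      (∀ᵐ t ∂(volume.restrict (Ioc 0 (genInv κ r))),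
        ∫ s in (0 : ℝ)..t, κ (t - s) • (ι (u s) - u₀) = ∫ s in (0 : ℝ)..t, f s) →
      ∃ (a₀ : X₀) (a₁ : X₁), ι a₀ + a₁ = u₀ ∧
        ‖a₀‖ₑ ≤ ENNReal.ofReal c *
          ((∫⁻ s in Ioc 0 (genInv κ r), ‖u s‖ₑ) / ENNReal.ofReal (genInv κ r)) ∧
        ENNReal.ofReal r * ‖a₁‖ₑ ≤ ENNReal.ofReal c *
          ((∫⁻ s in Ioc 0 (genInv κ r), ‖f s‖ₑ) / ENNReal.ofReal (genInv κ r)) := by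
  obtain ⟨D, hD1, hD⟩ := exists_doubling hκ_anti hκ
  obtain ⟨C, hC0, hC⟩ := integral_kernel_le hκ_anti hκ
  -- The factor `2` comes from `k₁ ≥ τ² κ(τ) / 2`; `C` enters through `K τ ≤ C τ κ(τ)` and `D`
  -- through `r ≤ D κ(τ)`.
  refine ⟨max (2 * C) (2 * D), lt_max_of_lt_left (by positivity), ?_⟩
  intro X₀ X₁ _ _ _ _ _ _ ι u f u₀ r hr hu hf heq
  have hτ := genInv_pos hκ_anti hκ hr
  have hrκ := le_mul_kernel_genInv hκ_anti hκ hD hr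
  set τ := genInv κ r
  have hκτ := hκ.1 τ hτ
  set K : ℝ → ℝ := fun t => ∫ x in (0 : ℝ)..t, κ x with hK
  have hKmono : ∀ {x y : ℝ}, 0 ≤ x → x ≤ y → K x ≤ K y := fun hx hxy =>
    integral_kernel_mono hκ_anti hκ hx hxy
  have hK0 : ∀ {x : ℝ}, 0 ≤ x → 0 ≤ K x := fun hx => by
    simpa [hK] using hKmono le_rfl hx
  have hKbound : ∀ s ∈ Ioc 0 τ, ‖K (τ - s)‖ ≤ K τ := fun s hs => by
    rw [Real.norm_of_nonneg (hK0 (by linarith [hs.2]))]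
    exact hKmono (by linarith [hs.2]) (by linarith [hs.1])
  have hKm : AEStronglyMeasurable (fun s => K (τ - s)) (volume.restrict (Ioc 0 τ)) := by
    refine (aemeasurable_restrict_of_antitoneOn measurableSet_Ioc ?_).aestronglyMeasurable
    intro x hx y hy hxy
    exact hKmono (by linarith [hy.2]) (by linarith)
  have hKb : ∀ᵐ s ∂(volume.restrict (Ioc 0 τ)), ‖K (τ - s)‖ ≤ K τ :=
    (ae_restrict_iff' measurableSet_Ioc).2 (ae_of_all _ hKbound)
  have hιu : IntegrableOn (fun s => ι (u s)) (Ioc 0 τ) := ι.integrable_comp hu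
  have hconst : IntegrableOn (fun _ : ℝ => u₀) (Ioc 0 τ) := by
    simp [integrableOn_const_iff]
  have hKu : IntegrableOn (fun s => K (τ - s) • u s) (Ioc 0 τ) := hu.bdd_smul (K τ) hKm hKb
  have hKιu : IntegrableOn (fun s => K (τ - s) • ι (u s)) (Ioc 0 τ) :=
    hιu.bdd_smul (K τ) hKm hKb
  have hKu₀ : IntegrableOn (fun s => K (τ - s) • u₀) (Ioc 0 τ) :=
    hconst.bdd_smul (K τ) hKm hKb
  have hK1 : IntegrableOn (fun s => K (τ - s)) (Ioc 0 τ) := by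
    simpa [IntegrableOn] using Integrable.bdd_mul (c := K τ)
      (integrableOn_const (C := (1 : ℝ)) (s := Ioc 0 τ) (by simp)) hKm hKb
  set k₁ := ∫ s in Ioc 0 τ, K (τ - s) with hk₁
  have hk₁_ge : τ ^ 2 * κ τ / 2 ≤ k₁ := by
    have h1 : ∫ s in (0 : ℝ)..τ, (τ - s) * κ τ = τ ^ 2 * κ τ / 2 := by
      rw [intervalIntegral.integral_mul_const, intervalIntegral.integral_comp_sub_left (fun x => x)]
      simp
      ring
    rw [← h1, intervalIntegral.integral_of_le hτ.le, hk₁]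
    refine setIntegral_mono_on (Continuous.integrableOn_Ioc (by fun_prop)) hK1 measurableSet_Ioc ?_
    intro s hs
    exact mul_kernel_le_integral hκ_anti hκ (by linarith [hs.2]) (by linarith [hs.1]) hτ
  have hk₁_pos : 0 < k₁ := lt_of_lt_of_le (by positivity) hk₁_ge
  have hmain : (∫ s in Ioc 0 τ, K (τ - s) • ι (u s)) - k₁ • u₀ = ∫ s in Ioc 0 τ, (τ - s) • f s := by
    have h1 : ∫ t in (0 : ℝ)..τ, ∫ s in (0 : ℝ)..t, κ (t - s) • (ι (u s) - u₀) =
        ∫ t in (0 : ℝ)..τ, ∫ s in (0 : ℝ)..t, f s := by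
      rw [intervalIntegral.integral_of_le hτ.le, intervalIntegral.integral_of_le hτ.le]
      exact integral_congr_ae heq
    -- The right side is a convolution with the kernel `1`, whose primitive yields the factor `τ -
    -- s`.
    have h2 := integral_integral_convolution (k := fun _ => 1) hτ.le
      (integrableOn_const (by simp)) hf
    rw [integral_integral_convolution (v := fun s => ι (u s) - u₀) hτ.le
      (integrableOn_kernel hκ_anti hκ τ) (hιu.sub hconst)] at h1
    simp only [one_smul, intervalIntegral.integral_const, smul_eq_mul, mul_one, sub_zero] at h2
    rw [h2, intervalIntegral.integral_of_le hτ.le, intervalIntegral.integral_of_le hτ.le] at h1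
    rw [← h1, hk₁, ← integral_smul_const, ← integral_sub hKιu hKu₀]
    simp only [smul_sub, hK]
  refine ⟨k₁⁻¹ • ∫ s in Ioc 0 τ, K (τ - s) • u s, -(k₁⁻¹ • ∫ s in Ioc 0 τ, (τ - s) • f s),
    ?_, ?_, ?_⟩
  · rw [map_smul, ← ι.integral_comp_comm hKu, ← hmain]
    simp only [map_smul, smul_sub, smul_smul, inv_mul_cancel₀ hk₁_pos.ne', one_smul]
    abel
  · have h1 : k₁⁻¹ * K τ ≤ max (2 * C) (2 * D) / τ := by
      rw [inv_mul_le_iff₀ hk₁_pos, mul_div_assoc', le_div_iff₀ hτ]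
      calc K τ * τ ≤ C * (τ * κ τ) * τ := by gcongr; exact hC τ hτ
        _ = τ ^ 2 * κ τ / 2 * (2 * C) := by ring
        _ ≤ k₁ * max (2 * C) (2 * D) := by gcongr; exact le_max_left _ _
    calc ‖k₁⁻¹ • ∫ s in Ioc 0 τ, K (τ - s) • u s‖ₑ
        ≤ ENNReal.ofReal k₁⁻¹ * ∫⁻ s in Ioc 0 τ, ENNReal.ofReal (K τ) * ‖u s‖ₑ := by
          rw [enorm_smul, Real.enorm_of_nonneg (by positivity)]
          gcongr
          refine (enorm_integral_le_lintegral_enorm _).trans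
            (setLIntegral_mono' measurableSet_Ioc fun s hs => ?_)
          rw [enorm_smul, ← ofReal_norm (K (τ - s))]
          gcongr
          exact hKbound s hs
      _ = ENNReal.ofReal (k₁⁻¹ * K τ) * ∫⁻ s in Ioc 0 τ, ‖u s‖ₑ := by
          rw [lintegral_const_mul' _ _ ENNReal.ofReal_ne_top, ENNReal.ofReal_mul (by positivity),
            mul_assoc]
      _ ≤ ENNReal.ofReal (max (2 * C) (2 * D) / τ) * ∫⁻ s in Ioc 0 τ, ‖u s‖ₑ := by gcongr
      _ = _ := by
          rw [ENNReal.ofReal_div_of_pos hτ, ENNReal.div_eq_inv_mul, ENNReal.div_eq_inv_mul]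
          ring
  · have h1 : r * (k₁⁻¹ * τ) ≤ max (2 * C) (2 * D) / τ := by
      rw [mul_left_comm, inv_mul_le_iff₀ hk₁_pos, mul_div_assoc', le_div_iff₀ hτ]
      calc r * τ * τ ≤ D * κ τ * τ * τ := by gcongr
        _ = τ ^ 2 * κ τ / 2 * (2 * D) := by ring
        _ ≤ k₁ * max (2 * C) (2 * D) := by gcongr; exact le_max_right _ _
    calc ENNReal.ofReal r * ‖-(k₁⁻¹ • ∫ s in Ioc 0 τ, (τ - s) • f s)‖ₑ
        ≤ ENNReal.ofReal r *
            (ENNReal.ofReal k₁⁻¹ * ∫⁻ s in Ioc 0 τ, ENNReal.ofReal τ * ‖f s‖ₑ) := by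
          rw [enorm_neg, enorm_smul, Real.enorm_of_nonneg (by positivity)]
          gcongr
          refine (enorm_integral_le_lintegral_enorm _).trans
            (setLIntegral_mono' measurableSet_Ioc fun s hs => ?_)
          rw [enorm_smul, Real.enorm_of_nonneg (by linarith [hs.2])]
          gcongr
          linarith [hs.1]
      _ = ENNReal.ofReal (r * (k₁⁻¹ * τ)) * ∫⁻ s in Ioc 0 τ, ‖f s‖ₑ := by
          rw [lintegral_const_mul' _ _ ENNReal.ofReal_ne_top, ENNReal.ofReal_mul hr.le,
            ENNReal.ofReal_mul (by positivity)]
          ring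
      _ ≤ ENNReal.ofReal (max (2 * C) (2 * D) / τ) * ∫⁻ s in Ioc 0 τ, ‖f s‖ₑ := by gcongr
      _ = _ := by
          rw [ENNReal.ofReal_div_of_pos hτ, ENNReal.div_eq_inv_mul, ENNReal.div_eq_inv_mul]
          ring

/-! ### Choice of the geometric ratio, and integrals against `dt / t`. -/

/-- Both bounds ask that `S(l) / l^p` be small. The first is the absorption condition in the Hardy
inequality, the second makes the series for small `t` in the interpolation norm converge. -/
theorem exists_ratio {p : ℝ} (B : ℝ) (hp : 1 < p) {S : ℝ → ℝ≥0∞}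
    (hS : Tendsto (fun r : ℝ => S r / ENNReal.ofReal (r ^ p)) atTop (𝓝 0)) :
    ∃ l : ℝ, 1 < l ∧ 2 ^ (p - 1) * (S l * ENNReal.ofReal (B / l) ^ p) ≤ 2⁻¹ ∧
      S l ≤ ENNReal.ofReal l ^ p * 2⁻¹ := by
  have hp0 : 0 < p := by linarith
  set A : ℝ≥0∞ := 2 ^ (p - 1) * ENNReal.ofReal B ^ p with hA
  have hAt : A ≠ ∞ := ENNReal.mul_ne_top
    (ENNReal.rpow_ne_top_of_nonneg (by linarith) (by norm_num))
    (ENNReal.rpow_ne_top_of_nonneg hp0.le ENNReal.ofReal_ne_top)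
  have hε : 0 < min (2⁻¹ : ℝ≥0∞) (2⁻¹ / A) := by
    refine lt_min (by norm_num) (ENNReal.div_pos (by norm_num) hAt)
  obtain ⟨l, hl, hl1⟩ := ((hS.eventually (gt_mem_nhds hε)).and (eventually_gt_atTop 1)).exists
  have hl0 : 0 < l := by linarith
  have hlp : ENNReal.ofReal l ^ p ≠ 0 :=
    (ENNReal.rpow_pos (ENNReal.ofReal_pos.2 hl0) ENNReal.ofReal_ne_top).ne'
  have hlt : ENNReal.ofReal l ^ p ≠ ∞ := ENNReal.rpow_ne_top_of_nonneg hp0.le ENNReal.ofReal_ne_top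
  rw [← ENNReal.ofReal_rpow_of_pos hl0] at hl
  refine ⟨l, hl1, ?_, ?_⟩
  · have h1 : S l / ENNReal.ofReal l ^ p ≤ 2⁻¹ / A := hl.le.trans (min_le_right _ _)
    calc 2 ^ (p - 1) * (S l * ENNReal.ofReal (B / l) ^ p)
        = A * (S l / ENNReal.ofReal l ^ p) := by
          rw [ENNReal.ofReal_div_of_pos hl0, ENNReal.div_rpow_of_nonneg _ _ hp0.le, hA,
            div_eq_mul_inv, div_eq_mul_inv]
          ring
      _ ≤ A * (2⁻¹ / A) := by gcongr
      _ ≤ 2⁻¹ := ENNReal.mul_div_le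
  · have h1 : S l / ENNReal.ofReal l ^ p ≤ 2⁻¹ := hl.le.trans (min_le_left _ _)
    rw [mul_comm]
    exact (ENNReal.div_le_iff hlp hlt).1 h1

theorem setLIntegral_mul_inv_le {a l : ℝ} (ha : 0 < a) {I : Set ℝ}
    (hI : MeasurableSet I) (hIa : I ⊆ Icc a (l * a)) {F : ℝ → ℝ≥0∞} {E : ℝ≥0∞}
    (hF : ∀ t ∈ I, F t ≤ E) :
    ∫⁻ t in I, F t * ENNReal.ofReal t⁻¹ ≤ E * ENNReal.ofReal (l - 1) := by
  calc ∫⁻ t in I, F t * ENNReal.ofReal t⁻¹ ≤ ∫⁻ _ in I, E * ENNReal.ofReal a⁻¹ := by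
        refine setLIntegral_mono' hI fun t ht => ?_
        gcongr
        · exact hF t ht
        · exact (hIa ht).1
    _ = E * ENNReal.ofReal a⁻¹ * volume I := setLIntegral_const _ _
    _ ≤ E * ENNReal.ofReal a⁻¹ * volume (Icc a (l * a)) := by gcongr
    _ = _ := by
        rw [Real.volume_Icc, mul_assoc, ← ENNReal.ofReal_mul (by positivity)]
        congr 2
        field_simp

/-! ### The primitive of the weight along the inverse kernel, and weighted `L_p` spaces. -/

section Weight

variable {w : ℝ → ℝ≥0} {κ : ℝ → ℝ} {p : ℝ}

/-- Positivity excludes the default value `0` of a non-integrable interval integral. -/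
theorem ofReal_weightPrimitive {τ : ℝ} (hτ : 0 ≤ τ)
    (h : 0 < weightPrimitive w τ) :
    ENNReal.ofReal (weightPrimitive w τ) = ∫⁻ t in Ioc 0 τ, (w t : ℝ≥0∞) := by
  have h1 : IntervalIntegrable (fun s => (w s : ℝ)) volume 0 τ := by
    by_contra h'
    rw [weightPrimitive, intervalIntegral.integral_undef h'] at h
    exact lt_irrefl _ h
  rw [weightPrimitive, intervalIntegral.integral_of_le hτ,
    ofReal_integral_eq_lintegral_ofReal ((intervalIntegrable_iff_integrableOn_Ioc_of_le hτ).1 h1)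
      (ae_of_all _ fun s => NNReal.coe_nonneg _)]
  simp

theorem weightPrimitive_genInv_pos (hW : ClassIo 0 p (weightPrimitive w ∘ kappaStar κ)) {r : ℝ}
    (hr : 0 < r) : 0 < weightPrimitive w (genInv κ r) := by
  simpa [kappaStar] using hW.1 (1 / r) (by positivity)

theorem ofReal_weightPrimitive_genInv (hκ_anti : AntitoneOn κ (Ioi 0)) (hκ : ClassIo (-1) 0 κ)
    (hW : ClassIo 0 p (weightPrimitive w ∘ kappaStar κ)) {r : ℝ}
    (hr : 0 < r) :
    ENNReal.ofReal (weightPrimitive w (genInv κ r)) =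
      ∫⁻ t in Ioc 0 (genInv κ r), (w t : ℝ≥0∞) :=
  ofReal_weightPrimitive (genInv_pos hκ_anti hκ hr).le (weightPrimitive_genInv_pos hW hr)

theorem lintegral_weight_genInv_ne_zero (hκ_anti : AntitoneOn κ (Ioi 0)) (hκ : ClassIo (-1) 0 κ)
    (hW : ClassIo 0 p (weightPrimitive w ∘ kappaStar κ)) {r : ℝ}
    (hr : 0 < r) : ∫⁻ t in Ioc 0 (genInv κ r), (w t : ℝ≥0∞) ≠ 0 := by
  rw [← ofReal_weightPrimitive_genInv hκ_anti hκ hW hr]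
  exact (ENNReal.ofReal_pos.2 (weightPrimitive_genInv_pos hW hr)).ne'

theorem lintegral_weight_genInv_le (hκ_anti : AntitoneOn κ (Ioi 0)) (hκ : ClassIo (-1) 0 κ)
    (hW : ClassIo 0 p (weightPrimitive w ∘ kappaStar κ)) {l r : ℝ}
    (hl : 0 < l) (hr : 0 < r) {s : ℝ≥0∞}
    (hs : growthSup (weightPrimitive w ∘ kappaStar κ) l ≤ s) :
    ∫⁻ t in Ioc 0 (genInv κ r), (w t : ℝ≥0∞) ≤
      s * ∫⁻ t in Ioc 0 (genInv κ (l * r)), (w t : ℝ≥0∞) := by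
  have hlr : 0 < l * r := by positivity
  -- At the point `t = 1 / (l r)` one has `κ*(l t) = κ⁻¹(r)` and `κ*(t) = κ⁻¹(l r)`.
  have h1 := (le_iSup₂ (f := fun (t : ℝ) (_ : 0 < t) => ENNReal.ofReal
    ((weightPrimitive w ∘ kappaStar κ) (l * t) / (weightPrimitive w ∘ kappaStar κ) t))
    (1 / (l * r)) (by positivity)).trans hs
  have h2 : 1 / (l * (1 / (l * r))) = r := by field_simp
  have hpos := weightPrimitive_genInv_pos hW hlr
  simp only [Function.comp, kappaStar, h2, one_div_one_div] at h1
  rw [ENNReal.ofReal_div_of_pos hpos, ENNReal.div_le_iff (by simpa using hpos)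
    ENNReal.ofReal_ne_top, ofReal_weightPrimitive_genInv hκ_anti hκ hW hr,
    ofReal_weightPrimitive_genInv hκ_anti hκ hW hlr] at h1
  exact h1

theorem lintegral_weight_genInv_inv_pow_le (hκ_anti : AntitoneOn κ (Ioi 0))
    (hκ : ClassIo (-1) 0 κ)
    (hW : ClassIo 0 p (weightPrimitive w ∘ kappaStar κ)) {l r : ℝ}
    (hl : 0 < l) (hr : 0 < r) {s : ℝ≥0∞}
    (hs : growthSup (weightPrimitive w ∘ kappaStar κ) l ≤ s) (n : ℕ) :
    ∫⁻ t in Ioc 0 (genInv κ (l⁻¹ ^ n * r)), (w t : ℝ≥0∞) ≤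
      s ^ n * ∫⁻ t in Ioc 0 (genInv κ r), (w t : ℝ≥0∞) := by
  induction n with
  | zero => simp
  | succ n ih =>
    have h1 := lintegral_weight_genInv_le (r := l⁻¹ ^ (n + 1) * r) hκ_anti hκ hW hl
      (by positivity) hs
    rw [show l * (l⁻¹ ^ (n + 1) * r) = l⁻¹ ^ n * r by rw [pow_succ]; field_simp] at h1
    calc _ ≤ _ := h1
      _ ≤ s * (s ^ n * ∫⁻ t in Ioc 0 (genInv κ r), (w t : ℝ≥0∞)) := by gcongr
      _ = _ := by ring

theorem lintegral_weightedMeasure (hw : Measurable w) (T : ℝ) (g : ℝ → ℝ≥0∞) :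
    ∫⁻ t, g t ∂(weightedMeasure w T) = ∫⁻ t in Ioo 0 T, g t * w t := by
  rw [weightedMeasure, lintegral_withDensity_eq_lintegral_mul_non_measurable _ (by fun_prop)
    (ae_of_all _ fun t => ENNReal.coe_lt_top)]
  simp only [Pi.mul_apply, mul_comm]

theorem aestronglyMeasurable_of_weightedMeasure {E : Type*} [NormedAddCommGroup E] (hp : 1 < p)
    (hw : Measurable w) (hA : apConst p w ≠ ∞) {τ T : ℝ} (hτ : 0 < τ) (hτT : τ < T)
    (hW : ∫⁻ t in Ioc 0 τ, (w t : ℝ≥0∞) ≠ 0) {h : ℝ → E}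
    (hh : AEStronglyMeasurable h (weightedMeasure w T)) :
    AEStronglyMeasurable h (volume.restrict (Ioc 0 τ)) := by
  have h1 : volume.restrict (Ioc 0 τ) ≪
      (volume.restrict (Ioc 0 τ)).withDensity fun t => (w t : ℝ≥0∞) :=
    withDensity_absolutelyContinuous' (by fun_prop) (ae_weight_ne_zero hp hw hA hτ hW)
  have h2 : (volume.restrict (Ioc 0 τ)).withDensity (fun t => (w t : ℝ≥0∞)) ≤
      weightedMeasure w T := by
    rw [weightedMeasure, ← restrict_withDensity measurableSet_Ioc,
      ← restrict_withDensity measurableSet_Ioo]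
    exact Measure.restrict_mono_set _ fun t ht => ⟨ht.1, ht.2.trans_lt hτT⟩
  exact (hh.mono_measure h2).mono_ac h1

theorem eLpNorm_weightedMeasure {E : Type*} [NormedAddCommGroup E] (hp : 1 < p) (h : ℝ → E)
    (T : ℝ) : eLpNorm h (ENNReal.ofReal p) (weightedMeasure w T) =
      (∫⁻ t, ‖h t‖ₑ ^ p ∂(weightedMeasure w T)) ^ (1 / p) := by
  rw [eLpNorm_eq_lintegral_rpow_enorm_toReal (by simp; linarith) ENNReal.ofReal_ne_top,
    ENNReal.toReal_ofReal (by linarith)]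

/-- The weighted Hölder inequality bounds the `L_1` mean by the weighted `L_p` norm; an infinite
mean would force an infinite right side, as `W(τ) ≠ 0`. -/
theorem integrableOn_of_memLp_weightedMeasure {E : Type*} [NormedAddCommGroup E] (hp : 1 < p)
    (hw : Measurable w) (hA : apConst p w ≠ ∞) {τ T : ℝ} (hτ : 0 < τ) (hτT : τ < T)
    (hW : ∫⁻ t in Ioc 0 τ, (w t : ℝ≥0∞) ≠ 0) {h : ℝ → E}
    (hh : MemLp h (ENNReal.ofReal p) (weightedMeasure w T)) : IntegrableOn h (Ioc 0 τ) := by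
  have hm := aestronglyMeasurable_of_weightedMeasure hp hw hA hτ hτT hW hh.1
  refine ⟨hm, ?_⟩
  have h1 := mul_div_rpow_lintegral_le hp hw hA hτ hW subset_rfl hm.enorm
  have h2 : ∫⁻ t in Ioc 0 τ, ‖h t‖ₑ ^ p * w t < ∞ := by
    refine lt_of_le_of_lt (lintegral_mono_set (t := Ioo 0 T)
      fun t ht => ⟨ht.1, ht.2.trans_lt hτT⟩) ?_
    rw [← lintegral_weightedMeasure hw T fun t => ‖h t‖ₑ ^ p]
    have h3 := hh.2
    rw [eLpNorm_weightedMeasure hp] at h3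
    exact (ENNReal.rpow_lt_top_iff_of_pos (by simp; linarith)).1 h3
  have h3 := h1.trans_lt (ENNReal.mul_lt_top hA.lt_top h2)
  rw [HasFiniteIntegral]
  by_contra! h4
  rw [top_le_iff.1 h4, ENNReal.top_div_of_ne_top ENNReal.ofReal_ne_top,
    ENNReal.top_rpow_of_pos (by linarith), ENNReal.mul_top hW] at h3
  exact lt_irrefl _ h3

end Weight

/-! ### The `K`-functional and the discretized interpolation norm. -/

section KFunctional

variable {X₀ X₁ : Type*} [NormedAddCommGroup X₀] [NormedSpace ℝ X₀]
  [NormedAddCommGroup X₁] [NormedSpace ℝ X₁] (ι : X₀ →L[ℝ] X₁)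

theorem kFunctional_le_of_add_eq {a₀ : X₀} {a₁ a : X₁} (h : ι a₀ + a₁ = a) (t : ℝ) :
    kFunctional ι.toLinearMap (LinearMap.id : X₁ →ₗ[ℝ] X₁) t a ≤
      ‖a₀‖ₑ + ENNReal.ofReal t * ‖a₁‖ₑ :=
  iInf_le_of_le a₀ (iInf_le_of_le a₁ (iInf_le_of_le h le_rfl))

theorem kFunctional_le_mul_enorm (a : X₁) (t : ℝ) :
    kFunctional ι.toLinearMap (LinearMap.id : X₁ →ₗ[ℝ] X₁) t a ≤ ENNReal.ofReal t * ‖a‖ₑ := by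
  simpa using kFunctional_le_of_add_eq ι (a₀ := 0) (a₁ := a) (a := a) (by simp) t

theorem kFunctional_le_of_le_mul {a₀ : X₀} {a₁ a : X₁} (h : ι a₀ + a₁ = a) {l r t : ℝ}
    (hl : 1 ≤ l) (ht : t ≤ l * r) :
    kFunctional ι.toLinearMap (LinearMap.id : X₁ →ₗ[ℝ] X₁) t a ≤
      ENNReal.ofReal l * (‖a₀‖ₑ + ENNReal.ofReal r * ‖a₁‖ₑ) := by
  have hl' : 1 ≤ ENNReal.ofReal l := ENNReal.one_le_ofReal.2 hl
  calc _ ≤ ‖a₀‖ₑ + ENNReal.ofReal t * ‖a₁‖ₑ := kFunctional_le_of_add_eq ι h t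
    _ ≤ ENNReal.ofReal l * ‖a₀‖ₑ + ENNReal.ofReal (l * r) * ‖a₁‖ₑ := by
        gcongr
        exact le_mul_of_one_le_left' hl'
    _ = _ := by rw [ENNReal.ofReal_mul (by linarith)]; ring

/-- The embedding constant enters here: a single decomposition controls the `X₁` norm, which is all
that small `t` requires. -/
theorem enorm_le_of_add_eq {a₀ : X₀} {a₁ a : X₁} (h : ι a₀ + a₁ = a) {L : ℝ≥0}
    (hL : ∀ x, ‖ι x‖ ≤ L * ‖x‖) {r : ℝ} (hr : 0 < r) :
    ‖a‖ₑ ≤ (L + ENNReal.ofReal r⁻¹) * (‖a₀‖ₑ + ENNReal.ofReal r * ‖a₁‖ₑ) := by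
  have h1 : ‖ι a₀‖ₑ ≤ L * ‖a₀‖ₑ := by
    simp only [enorm_eq_nnnorm]
    exact_mod_cast hL a₀
  have h2 : ‖a₁‖ₑ = ENNReal.ofReal r⁻¹ * (ENNReal.ofReal r * ‖a₁‖ₑ) := by
    rw [← mul_assoc, ← ENNReal.ofReal_mul (by positivity), inv_mul_cancel₀ hr.ne',
      ENNReal.ofReal_one, one_mul]
  calc ‖a‖ₑ ≤ ‖ι a₀‖ₑ + ‖a₁‖ₑ := h ▸ enorm_add_le _ _
    _ ≤ L * ‖a₀‖ₑ + ENNReal.ofReal r⁻¹ * (ENNReal.ofReal r * ‖a₁‖ₑ) := by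
        rw [← h2]; gcongr
    _ ≤ L * (‖a₀‖ₑ + ENNReal.ofReal r * ‖a₁‖ₑ) +
        ENNReal.ofReal r⁻¹ * (‖a₀‖ₑ + ENNReal.ofReal r * ‖a₁‖ₑ) := by
        gcongr
        · exact le_self_add
        · exact le_add_self
    _ = _ := by ring

end KFunctional

/-- The interpolation norm is controlled by decompositions along a geometric sequence. -/
theorem lintegral_kFunctional_le {p : ℝ} (hp : 1 < p) {κ : ℝ → ℝ}
    (hκ_anti : AntitoneOn κ (Ioi 0)) (hκ : ClassIo (-1) 0 κ) {w : ℝ → ℝ≥0}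
    (hW : ClassIo 0 p (weightPrimitive w ∘ kappaStar κ)) {l r₀ : ℝ} (hl : 1 < l) (hr₀ : 0 < r₀)
    {s : ℝ≥0∞} (hs : growthSup (weightPrimitive w ∘ kappaStar κ) l ≤ s)
    (hsl : s ≤ ENNReal.ofReal l ^ p * 2⁻¹) {X₀ X₁ : Type*}
    [NormedAddCommGroup X₀] [NormedSpace ℝ X₀] [NormedAddCommGroup X₁] [NormedSpace ℝ X₁]
    (ι : X₀ →L[ℝ] X₁) {L : ℝ≥0} (hL : ∀ x, ‖ι x‖ ≤ L * ‖x‖) {a : X₁} {X : ℕ → ℝ≥0∞}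
    (hX : ∀ n : ℕ, ∃ (a₀ : X₀) (a₁ : X₁), ι a₀ + a₁ = a ∧
      ‖a₀‖ₑ + ENNReal.ofReal (l ^ n * r₀) * ‖a₁‖ₑ ≤ X n) :
    ∫⁻ t in Ioi (0 : ℝ), (ENNReal.ofReal (weightPrimitive w (kappaStar κ t⁻¹) ^ (1 / p)) *
        kFunctional ι.toLinearMap (LinearMap.id : X₁ →ₗ[ℝ] X₁) t a) ^ p * ENNReal.ofReal t⁻¹ ≤
      ((ENNReal.ofReal l * ENNReal.ofReal r₀ * (L + ENNReal.ofReal r₀⁻¹)) ^ p +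
        ENNReal.ofReal l ^ p) * ENNReal.ofReal (l - 1) *
        ∑' n : ℕ, (∫⁻ t in Ioc 0 (genInv κ (l ^ n * r₀)), (w t : ℝ≥0∞)) * X n ^ p := by
  have hp0 : 0 < p := by linarith
  have hl0 : 0 < l := by linarith
  set V : ℝ → ℝ≥0∞ := fun r => ∫⁻ t in Ioc 0 (genInv κ r), (w t : ℝ≥0∞) with hV
  set K : ℝ → ℝ≥0∞ := fun t => kFunctional ι.toLinearMap (LinearMap.id : X₁ →ₗ[ℝ] X₁) t a
  set Q := ∑' n : ℕ, V (l ^ n * r₀) * X n ^ p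
  have hVanti : ∀ {r t : ℝ}, 0 < r → r ≤ t → V t ≤ V r := fun hr hrt =>
    lintegral_mono_set (Ioc_subset_Ioc_right (genInv_anti hκ hr hrt))
  have hint : ∀ t ∈ Ioi (0 : ℝ),
      (ENNReal.ofReal (weightPrimitive w (kappaStar κ t⁻¹) ^ (1 / p)) * K t) ^ p *
        ENNReal.ofReal t⁻¹ = V t * K t ^ p * ENNReal.ofReal t⁻¹ := by
    intro t ht
    have hpos := weightPrimitive_genInv_pos hW ht
    rw [kappaStar, one_div, inv_inv, ← ENNReal.ofReal_rpow_of_pos hpos,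
      ENNReal.mul_rpow_of_nonneg _ _ hp0.le, ← ENNReal.rpow_mul, one_div_mul_cancel hp0.ne',
      ENNReal.rpow_one, ofReal_weightPrimitive_genInv hκ_anti hκ hW ht]
  have hlow : ∫⁻ t in Ioc 0 r₀, V t * K t ^ p * ENNReal.ofReal t⁻¹ ≤
      (ENNReal.ofReal l * ENNReal.ofReal r₀ * (L + ENNReal.ofReal r₀⁻¹)) ^ p *
        ENNReal.ofReal (l - 1) * Q := by
    have hnorm : V r₀ * ‖a‖ₑ ^ p ≤ (L + ENNReal.ofReal r₀⁻¹) ^ p * Q := by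
      obtain ⟨a₀, a₁, h1, h2⟩ := hX 0
      rw [pow_zero, one_mul] at h2
      calc V r₀ * ‖a‖ₑ ^ p ≤ V r₀ * ((L + ENNReal.ofReal r₀⁻¹) * X 0) ^ p := by
            gcongr
            exact (enorm_le_of_add_eq ι h1 hL hr₀).trans (by gcongr)
        _ = (L + ENNReal.ofReal r₀⁻¹) ^ p * (V (l ^ 0 * r₀) * X 0 ^ p) := by
            rw [ENNReal.mul_rpow_of_nonneg _ _ hp0.le, pow_zero, one_mul]; ring
        _ ≤ _ := by
            gcongr
            exact ENNReal.le_tsum (f := fun n : ℕ => V (l ^ n * r₀) * X n ^ p) 0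
    have hμ : 0 < l⁻¹ := inv_pos.2 hl0
    calc ∫⁻ t in Ioc 0 r₀, V t * K t ^ p * ENNReal.ofReal t⁻¹
        ≤ ∫⁻ t in ⋃ n : ℕ, Ioc (l⁻¹ ^ (n + 1) * r₀) (l⁻¹ ^ n * r₀),
            V t * K t ^ p * ENNReal.ofReal t⁻¹ :=
          lintegral_mono_set (Ioc_subset_iUnion_geometric hμ (inv_lt_one_of_one_lt₀ hl) hr₀)
      _ ≤ ∑' n : ℕ, ∫⁻ t in Ioc (l⁻¹ ^ (n + 1) * r₀) (l⁻¹ ^ n * r₀),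
            V t * K t ^ p * ENNReal.ofReal t⁻¹ := lintegral_iUnion_le _ _
      _ ≤ ∑' n : ℕ, 2⁻¹ ^ (n + 1) * (ENNReal.ofReal l ^ p * ENNReal.ofReal r₀ ^ p *
            (V r₀ * ‖a‖ₑ ^ p) * ENNReal.ofReal (l - 1)) := by
          refine ENNReal.tsum_le_tsum fun n => ?_
          have hpos : 0 < l⁻¹ ^ (n + 1) * r₀ := by positivity
          have hstep : l * (l⁻¹ ^ (n + 1) * r₀) = l⁻¹ ^ n * r₀ := by rw [pow_succ]; field_simp
          -- `V` is estimated at the left endpoint (exponent `n + 1`) and `K` at the right one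
          -- (exponent `n`), so one factor `l^p` survives; the decay is the `2⁻¹ ^ (n + 1)` from
          -- `hsl`.
          have hll : (ENNReal.ofReal l ^ p) ^ (n + 1) * ENNReal.ofReal (l⁻¹ ^ n * r₀) ^ p =
              ENNReal.ofReal l ^ p * ENNReal.ofReal r₀ ^ p := by
            rw [← ENNReal.rpow_mul_natCast, mul_comm p, ENNReal.rpow_mul, ENNReal.rpow_natCast,
              ← ENNReal.mul_rpow_of_nonneg _ _ hp0.le, ← ENNReal.mul_rpow_of_nonneg _ _ hp0.le,
              ← ENNReal.ofReal_pow hl0.le, ← ENNReal.ofReal_mul (by positivity),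
              ← ENNReal.ofReal_mul hl0.le]
            congr 2
            rw [inv_pow, pow_succ]
            field_simp
          have hb : ∀ t ∈ Ioc (l⁻¹ ^ (n + 1) * r₀) (l⁻¹ ^ n * r₀), V t * K t ^ p ≤
              2⁻¹ ^ (n + 1) * (ENNReal.ofReal l ^ p * ENNReal.ofReal r₀ ^ p *
                (V r₀ * ‖a‖ₑ ^ p)) := by
            intro t ht
            calc V t * K t ^ p
                ≤ ((ENNReal.ofReal l ^ p * 2⁻¹) ^ (n + 1) * V r₀) *
                  (ENNReal.ofReal (l⁻¹ ^ n * r₀) * ‖a‖ₑ) ^ p := by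
                  gcongr
                  · exact (hVanti hpos ht.1.le).trans (lintegral_weight_genInv_inv_pow_le
                      hκ_anti hκ hW hl0 hr₀ (hs.trans hsl) (n + 1))
                  · exact (kFunctional_le_mul_enorm ι a t).trans (by gcongr; exact ht.2)
              _ = 2⁻¹ ^ (n + 1) * (((ENNReal.ofReal l ^ p) ^ (n + 1) *
                    ENNReal.ofReal (l⁻¹ ^ n * r₀) ^ p) * (V r₀ * ‖a‖ₑ ^ p)) := by
                  rw [ENNReal.mul_rpow_of_nonneg _ _ hp0.le, mul_pow]; ring
              _ = _ := by rw [hll]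
          refine (setLIntegral_mul_inv_le (F := fun t => V t * K t ^ p) hpos measurableSet_Ioc
            (fun t ht => ⟨ht.1.le, hstep ▸ ht.2⟩) hb).trans (le_of_eq ?_)
          ring
      _ = (ENNReal.ofReal l * ENNReal.ofReal r₀) ^ p * (V r₀ * ‖a‖ₑ ^ p) *
            ENNReal.ofReal (l - 1) := by
          rw [ENNReal.tsum_mul_right, ENNReal.tsum_geometric_add_one, ENNReal.one_sub_inv_two,
            inv_inv, ENNReal.inv_mul_cancel (by norm_num) (by norm_num), one_mul,
            ENNReal.mul_rpow_of_nonneg _ _ hp0.le]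
      _ ≤ (ENNReal.ofReal l * ENNReal.ofReal r₀) ^ p * ((L + ENNReal.ofReal r₀⁻¹) ^ p * Q) *
            ENNReal.ofReal (l - 1) := by gcongr
      _ = _ := by
          rw [ENNReal.mul_rpow_of_nonneg (ENNReal.ofReal l * ENNReal.ofReal r₀) _ hp0.le]
          ring
  have hhigh : ∫⁻ t in Ioi r₀, V t * K t ^ p * ENNReal.ofReal t⁻¹ ≤
      ENNReal.ofReal l ^ p * ENNReal.ofReal (l - 1) * Q := by
    calc ∫⁻ t in Ioi r₀, V t * K t ^ p * ENNReal.ofReal t⁻¹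
        ≤ ∫⁻ t in ⋃ n : ℕ, Ico (l ^ n * r₀) (l ^ (n + 1) * r₀),
            V t * K t ^ p * ENNReal.ofReal t⁻¹ :=
          lintegral_mono_set (Ioi_subset_iUnion_geometric hl hr₀)
      _ ≤ ∑' n : ℕ, ∫⁻ t in Ico (l ^ n * r₀) (l ^ (n + 1) * r₀),
            V t * K t ^ p * ENNReal.ofReal t⁻¹ := lintegral_iUnion_le _ _
      _ ≤ ∑' n : ℕ, ENNReal.ofReal l ^ p * ENNReal.ofReal (l - 1) *
            (V (l ^ n * r₀) * X n ^ p) := by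
          refine ENNReal.tsum_le_tsum fun n => ?_
          have hpos : 0 < l ^ n * r₀ := by positivity
          have hstep : l ^ (n + 1) * r₀ = l * (l ^ n * r₀) := by ring
          obtain ⟨a₀, a₁, h1, h2⟩ := hX n
          -- The decomposition at the left endpoint serves the whole interval at the cost of a
          -- factor `l`, since `V` decreases.
          have hb : ∀ t ∈ Ico (l ^ n * r₀) (l ^ (n + 1) * r₀), V t * K t ^ p ≤
              V (l ^ n * r₀) * (ENNReal.ofReal l * X n) ^ p := by
            intro t ht
            gcongr
            · exact hVanti hpos ht.1
            · exact (kFunctional_le_of_le_mul ι h1 hl.le (hstep ▸ ht.2.le)).trans (by gcongr)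
          refine (setLIntegral_mul_inv_le (F := fun t => V t * K t ^ p) hpos measurableSet_Ico
            (fun t ht => ⟨ht.1, hstep ▸ ht.2.le⟩) hb).trans (le_of_eq ?_)
          rw [ENNReal.mul_rpow_of_nonneg _ _ hp0.le]
          ring
      _ = _ := ENNReal.tsum_mul_left
  calc _ = ∫⁻ t in Ioi (0 : ℝ), V t * K t ^ p * ENNReal.ofReal t⁻¹ :=
        setLIntegral_congr_fun measurableSet_Ioi hint
    _ = (∫⁻ t in Ioc 0 r₀, V t * K t ^ p * ENNReal.ofReal t⁻¹) +
        ∫⁻ t in Ioi r₀, V t * K t ^ p * ENNReal.ofReal t⁻¹ := by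
        rw [← Ioc_union_Ioi_eq_Ioi hr₀.le, lintegral_union measurableSet_Ioi]
        exact disjoint_left.2 fun x hx hx' => not_lt.2 hx.2 hx'
    _ ≤ _ := add_le_add hlow hhigh
    _ = _ := by ring

end VolterraTrace

/-! ### The trace theorem. -/

open VolterraTrace
theorem theorem5p3 (p T : ℝ) (hp : 1 < p) (hT : 0 < T)
    -- the kernel: right-continuous, decreasing, of class `I_o(-1, 0)`
    (κ : ℝ → ℝ) (hκ_anti : AntitoneOn κ (Ioi 0))
    (hκ_right : ∀ t : ℝ, 0 < t → ContinuousWithinAt κ (Ioi t) t)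
    (hκ : ClassIo (-1) 0 κ)
    -- bounds for `[w]_{A_p}` and for the embedding, and a majorant for `s_{W ∘ κ*}`
    (M L : ℝ≥0) (S : ℝ → ℝ≥0∞) (hS : IsLittleOEnds 0 p S) :
    ∃ N : ℝ≥0,
      ∀ (X₀ : Type u) (X₁ : Type v)
        [NormedAddCommGroup X₀] [NormedSpace ℝ X₀] [CompleteSpace X₀]
        [NormedAddCommGroup X₁] [NormedSpace ℝ X₁] [CompleteSpace X₁]
        (ι : X₀ →L[ℝ] X₁), Function.Injective ι → (∀ a : X₀, ‖ι a‖ ≤ L * ‖a‖) →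
      ∀ w : ℝ → ℝ≥0, IsApWeight p w → apConst p w ≤ M →
        ClassIo 0 p (weightPrimitive w ∘ kappaStar κ) →
        (∀ r : ℝ, 0 < r → growthSup (weightPrimitive w ∘ kappaStar κ) r ≤ S r) →
      ∀ (u : ℝ → X₀) (f : ℝ → X₁) (u₀ : X₁),
        MemLp u (ENNReal.ofReal p) (weightedMeasure w T) →
        MemLp f (ENNReal.ofReal p) (weightedMeasure w T) →
        (∀ᵐ t ∂(volume.restrict (Ioo 0 T)),
          ∫ s in (0 : ℝ)..t, κ (t - s) • (ι (u s) - u₀) = ∫ s in (0 : ℝ)..t, f s) →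
        u₀ ∈ interpSpace ι.toLinearMap (LinearMap.id : X₁ →ₗ[ℝ] X₁)
            (fun t => weightPrimitive w (kappaStar κ t) ^ (1 / p)) p ∧
          interpNorm ι.toLinearMap (LinearMap.id : X₁ →ₗ[ℝ] X₁)
              (fun t => weightPrimitive w (kappaStar κ t) ^ (1 / p)) p u₀ ≤
            N * (eLpNorm u (ENNReal.ofReal p) (weightedMeasure w T) +
              eLpNorm f (ENNReal.ofReal p) (weightedMeasure w T)) := by
  have hp0 : 0 < p := by linarith
  obtain ⟨c, hc, hdec⟩ := exists_decomposition.{u, v} hκ_anti hκ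
  obtain ⟨B, hB, hτB⟩ := exists_genInv_mul_le hκ_anti hκ
  -- The ratio is chosen from the majorant `S`, before the spaces and the weight are introduced;
  -- this makes `N` uniform.
  obtain ⟨l, hl, hlB, hlS⟩ := exists_ratio B hp hS.2
  obtain ⟨r₀, hr₀, hr₀T⟩ := exists_genInv_lt hκ hT
  set A : ℝ≥0∞ := ((ENNReal.ofReal l * ENNReal.ofReal r₀ * (L + ENNReal.ofReal r₀⁻¹)) ^ p +
    ENNReal.ofReal l ^ p) * ENNReal.ofReal (l - 1) with hAdef
  set N : ℝ≥0∞ := A * (ENNReal.ofReal c ^ p * ((2 * 2 ^ (p - 1) + 1) * M)) with hNdef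
  have hN : N ≠ ∞ := by
    have h2 : (2 : ℝ≥0∞) ^ (p - 1) ≠ ∞ := ENNReal.rpow_ne_top_of_nonneg (by linarith) (by simp)
    have hA : A ≠ ∞ := by
      refine ENNReal.mul_ne_top (ENNReal.add_ne_top.2
        ⟨ENNReal.rpow_ne_top_of_nonneg hp0.le ?_, ENNReal.rpow_ne_top_of_nonneg hp0.le ?_⟩) ?_
      · finiteness
      · finiteness
      · finiteness
    have hc' : ENNReal.ofReal c ^ p ≠ ∞ :=
      ENNReal.rpow_ne_top_of_nonneg hp0.le ENNReal.ofReal_ne_top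
    finiteness
  have hNp : N ^ (1 / p) ≠ ∞ := ENNReal.rpow_ne_top_of_nonneg (by positivity) hN
  refine ⟨(N ^ (1 / p)).toNNReal, ?_⟩
  intro X₀ X₁ _ _ _ _ _ _ ι _ hL w hw hM hW hgS u f u₀ hu hf heq
  have hl0 : 0 < l := by linarith
  have hA : apConst p w ≠ ∞ := hw.2.ne
  have hr : ∀ n : ℕ, 0 < l ^ n * r₀ := fun n => by positivity
  have hrmono : Monotone fun n : ℕ => l ^ n * r₀ := fun m n hmn =>
    mul_le_mul_of_nonneg_right (pow_le_pow_right₀ hl.le hmn) hr₀.le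
  set τ : ℕ → ℝ := fun n => genInv κ (l ^ n * r₀) with hτdef
  have hτ : ∀ n, 0 < τ n := fun n => genInv_pos hκ_anti hκ (hr n)
  have hτanti : Antitone τ := fun m n hmn => genInv_anti hκ (hr m) (hrmono hmn)
  have hτT : ∀ n, τ n < T := fun n =>
    (hτanti n.zero_le).trans_lt (by simpa [hτdef] using hr₀T)
  have hVne : ∀ n, ∫⁻ t in Ioc 0 (τ n), (w t : ℝ≥0∞) ≠ 0 := fun n =>
    lintegral_weight_genInv_ne_zero hκ_anti hκ hW (hr n)
  -- One application of the Hardy inequality treats `u` and `f` together; Minkowski separates them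
  -- in `hgG`.
  set g : ℝ → ℝ≥0∞ := fun t => ‖u t‖ₑ + ‖f t‖ₑ with hg
  have hui : ∀ n, IntegrableOn u (Ioc 0 (τ n)) := fun n =>
    integrableOn_of_memLp_weightedMeasure hp hw.1 hA (hτ n) (hτT n) (hVne n) hu
  have hfi : ∀ n, IntegrableOn f (Ioc 0 (τ n)) := fun n =>
    integrableOn_of_memLp_weightedMeasure hp hw.1 hA (hτ n) (hτT n) (hVne n) hf
  have hX : ∀ n : ℕ, ∃ (a₀ : X₀) (a₁ : X₁), ι a₀ + a₁ = u₀ ∧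
      ‖a₀‖ₑ + ENNReal.ofReal (l ^ n * r₀) * ‖a₁‖ₑ ≤
        ENNReal.ofReal c * ((∫⁻ t in Ioc 0 (τ n), g t) / ENNReal.ofReal (τ n)) := by
    intro n
    obtain ⟨a₀, a₁, h1, h2, h3⟩ := hdec X₀ X₁ ι u f u₀ (l ^ n * r₀) (hr n) (hui n) (hfi n)
      (ae_restrict_of_ae_restrict_of_subset (show Ioc 0 (τ n) ⊆ Ioo 0 T from
        fun t ht => ⟨ht.1, ht.2.trans_lt (hτT n)⟩) heq)
    refine ⟨a₀, a₁, h1, (add_le_add h2 h3).trans (le_of_eq ?_)⟩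
    rw [← mul_add, ← ENNReal.add_div, hg, lintegral_add_left' (hui n).1.enorm]
  have hgG : (∫⁻ t in Ioo 0 T, g t ^ p * w t) ^ (1 / p) ≤
      eLpNorm u (ENNReal.ofReal p) (weightedMeasure w T) +
        eLpNorm f (ENNReal.ofReal p) (weightedMeasure w T) := by
    rw [← lintegral_weightedMeasure hw.1 T fun t => g t ^ p, eLpNorm_weightedMeasure hp,
      eLpNorm_weightedMeasure hp]
    exact ENNReal.lintegral_Lp_add_le hu.1.enorm hf.1.enorm hp.le
  have hsum : eLpNorm u (ENNReal.ofReal p) (weightedMeasure w T) +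
      eLpNorm f (ENNReal.ofReal p) (weightedMeasure w T) < ∞ := ENNReal.add_lt_top.2 ⟨hu.2, hf.2⟩
  have hGle : ∫⁻ t in Ioc 0 (τ 0), g t ^ p * w t ≤ ∫⁻ t in Ioo 0 T, g t ^ p * w t :=
    lintegral_mono_set fun t ht => ⟨ht.1, ht.2.trans_lt (hτT 0)⟩
  have hGfin : ∫⁻ t in Ioo 0 T, g t ^ p * w t < ∞ :=
    (ENNReal.rpow_lt_top_iff_of_pos (by positivity)).1 (hgG.trans_lt hsum)
  have hhardy := tsum_weight_mul_average_le hp hw.1 hA hτ hτanti hVne (s := S l)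
    (b := ENNReal.ofReal (B / l))
    (fun n => by
      have h1 := lintegral_weight_genInv_le hκ_anti hκ hW hl0 (hr n) (hgS l hl0)
      rwa [← mul_assoc, ← pow_succ'] at h1)
    (fun n => by
      rw [← ENNReal.ofReal_mul (by positivity)]
      refine ENNReal.ofReal_le_ofReal ?_
      have h1 := hτB l (l ^ n * r₀) hl.le (hr n)
      rwa [← mul_assoc, ← pow_succ'] at h1)
    hlB ((hui 0).1.enorm.add (hfi 0).1.enorm) (hGle.trans_lt hGfin).ne
  have hmain := lintegral_kFunctional_le hp hκ_anti hκ hW hl hr₀ (hgS l hl0) hlS ι hL hX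
  have hbound : interpNorm ι.toLinearMap (LinearMap.id : X₁ →ₗ[ℝ] X₁)
      (fun t => weightPrimitive w (kappaStar κ t) ^ (1 / p)) p u₀ ≤
      (N ^ (1 / p)).toNNReal * (eLpNorm u (ENNReal.ofReal p) (weightedMeasure w T) +
        eLpNorm f (ENNReal.ofReal p) (weightedMeasure w T)) := by
    rw [ENNReal.coe_toNNReal hNp]
    refine le_trans (ENNReal.rpow_le_rpow (hmain.trans ?_) (by positivity))
      ((ENNReal.mul_rpow_of_nonneg N (∫⁻ t in Ioo 0 T, g t ^ p * w t)
        (by positivity : 0 ≤ 1 / p)).le.trans (mul_le_mul' le_rfl hgG))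
    calc _ = A * (ENNReal.ofReal c ^ p * ∑' n : ℕ, (∫⁻ t in Ioc 0 (τ n), (w t : ℝ≥0∞)) *
          ((∫⁻ t in Ioc 0 (τ n), g t) / ENNReal.ofReal (τ n)) ^ p) := by
          rw [← ENNReal.tsum_mul_left (a := ENNReal.ofReal c ^ p)]
          congr 1
          refine tsum_congr fun n => ?_
          rw [ENNReal.mul_rpow_of_nonneg _ _ hp0.le]
          ring
      _ ≤ A * (ENNReal.ofReal c ^ p * ((2 * 2 ^ (p - 1) + 1) * M *
          ∫⁻ t in Ioo 0 T, g t ^ p * w t)) := by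
          refine mul_le_mul' le_rfl (mul_le_mul' le_rfl (hhardy.trans ?_))
          exact mul_le_mul' (mul_le_mul' le_rfl hM) hGle
      _ = _ := by rw [hNdef]; ring
  exact ⟨⟨⟨0, u₀, by simp⟩, hbound.trans_lt (ENNReal.mul_lt_top ENNReal.coe_lt_top hsum)⟩, hbound⟩
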